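/- Let $\mathrm{UC}_c$ be the set of upper semicontinuous functions $\mathfrak h:\mathbb R\to[-\infty,\infty)$ with $\mathfrak h\not\equiv-\infty$ for which there is $L>0$ with $\mathfrak h(x)=-\infty$ for all $|x|>L$, and let $\mathrm{supp}(\mathfrak h)$ be the closure of $\{x:\mathfrak h(x)\neq-\infty\}$. Let $\mathbf B$ be a two-sided Brownian motion with diffusivity constant $2$ (i.e. $\mathbf B(t)-\mathbf B(0)$ has variance $2|t|$), write $\mathbb E_{\mathbf B(0)=s}$ for the expectation when it starts from $\mathbf B(0)=s$, and put $$\boldsymbol\tau_+=\inf\{\alpha\ge 0:\mathbf B(\alpha)\le\mathfrak h(\alpha)\},\qquad \boldsymbol\tau_-=\sup\{\alpha\le 0:\mathbf B(\alpha)\le\mathfrak h(\alpha)\}$$ (with $\inf\emptyset=\infty$, $\sup\emptyset=-\infty$). Let $\mathbb C_{\mathrm R}=\{\mathrm{Re}>0\}$, $\mathbb C_{\mathrm L}=\{\mathrm{Re}<0\}$. For $\eta\in\mathbb C_{\mathrm R}$, $\xi\in\mathbb C_{\mathrm L}$ and $s\in\mathbb R$ let $$E^+_\xi(s)=\mathbb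 E_{\mathbf B(0)=s}\big[e^{-\boldsymbol\tau_+\xi^2-\mathbf B(\boldsymbol\tau_+)\xi}\mathbf 1_{\boldsymbol\tau_+<\infty}\big],\qquad E^-_\eta(s)=\mathbb E_{\mathbf B(0)=s}\big[e^{\boldsymbol\tau_-\eta^2+\mathbf B(\boldsymbol\tau_-)\eta}\mathbf 1_{\boldsymbol\tau_->-\infty}\big],$$ $$\chi_{\mathfrak h}(\eta,\xi)=\int_{\mathbb R}e^{s\eta}E^+_\xi(s)\,ds+\int_{\mathbb R}e^{-s\xi}E^-_\eta(s)\,ds-\int_{\mathbb R}E^+_\xi(s)\,E^-_\eta(s)\,ds .$$ Proposition. Let $\mathfrak h\in\mathrm{UC}_c$. Then $\chi_{\mathfrak h}$ is well defined on $\mathbb C_{\mathrm R}\times\mathbb C_{\mathrm L}$, that is, for all $\eta\in\mathbb C_{\mathrm R}$ and $\xi\in\mathbb C_{\mathrm L}$ the expectations (for every $s\in\mathbb R$) and the three integrals converge absolutely, and $\chi_{\mathfrak h}$ is (jointly) analytic on $\mathbb C_{\mathrm R}\times\mathbb C_{\mathrm L}$. Moreover, for any $L>0$ and $\beta\in\mathbb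 R$ such that $\mathrm{supp}(\mathfrak h)\subset[-L,L]$ and $\mathfrak h(\alpha)\le\beta$ for all $\alpha\in\mathbb R$, and for all $\eta\in\mathbb C_{\mathrm R}$, $\xi\in\mathbb C_{\mathrm L}$, $$|\chi_{\mathfrak h}(\eta,\xi)|\le e^{(\beta+1)\mathrm{Re}(\eta-\xi)+2L(|\xi|^2+|\eta|^2)}\left(\frac{2}{\mathrm{Re}(\eta)}+\frac{2}{\mathrm{Re}(-\xi)}+8L+\frac{2^{5/2}L^{3/2}}{\sqrt\pi}\right).$$ -/

import Mathlib

open MeasureTheory ProbabilityTheory Filter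
open scoped NNReal

namespace KPZ

/-- The space `UC`: upper semicontinuous functions `h : ℝ → [-∞, ∞)`, not identically `-∞`, with
`limsup h(x) / x² ≤ 0` as `x → ±∞`. -/
structure IsUC (h : ℝ → EReal) : Prop where
  upperSemicontinuous : UpperSemicontinuous h
  ne_top : ∀ x, h x ≠ ⊤
  exists_ne_bot : ∃ x, h x ≠ ⊥
  limsup_atTop : limsup (fun x : ℝ => h x / ((x ^ 2 : ℝ) : EReal)) atTop ≤ 0
  limsup_atBot : limsup (fun x : ℝ => h x / ((x ^ 2 : ℝ) : EReal)) atBot ≤ 0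

/-- The space `UC_c`: functions of `UC` that are `-∞` outside a bounded interval. -/
structure IsUCc (h : ℝ → EReal) : Prop extends IsUC h where
  exists_eq_bot : ∃ L : ℝ, 0 < L ∧ ∀ x, L < |x| → h x = ⊥

/-- The support of `h`: the closure of the set where `h ≠ -∞`. -/
def supp (h : ℝ → EReal) : Set ℝ := closure {x | h x ≠ ⊥}

/-- `B` is a two-sided Brownian motion started at `0` with diffusivity constant `2`
(`Var (B t) = 2 |t|`): the two halves `t ↦ B t` and `t ↦ B (-t)`, `t ≥ 0`, are independent, and
each of them is `√2` times a standard Brownian motion. -/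
structure IsTwoSidedBrownian {Ω : Type*} [MeasurableSpace Ω]
    (B : ℝ → Ω → ℝ) (P : Measure Ω) : Prop where
  pos : IsBrownianReal (fun (t : ℝ≥0) ω => (√2)⁻¹ * B t ω) P
  neg : IsBrownianReal (fun (t : ℝ≥0) ω => (√2)⁻¹ * B (-t) ω) P
  indep : IndepFun (fun ω (t : ℝ≥0) => B t ω) (fun ω (t : ℝ≥0) => B (-t) ω) P

/-- Times `α ≥ 0` at which the path `f` is in the hypograph of `h`. -/
def hitSetPos (h : ℝ → EReal) (f : ℝ → ℝ) : Set ℝ := {α | 0 ≤ α ∧ (f α : EReal) ≤ h α}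

/-- Times `α ≤ 0` at which the path `f` is in the hypograph of `h`. -/
def hitSetNeg (h : ℝ → EReal) (f : ℝ → ℝ) : Set ℝ := {α | α ≤ 0 ∧ (f α : EReal) ≤ h α}

/-- The hitting time `τ₊ = inf {α ≥ 0 : f α ≤ h α}`. It is only used when the set is nonempty,
that is, when `τ₊ < ∞`. -/
noncomputable def tauPos (h : ℝ → EReal) (f : ℝ → ℝ) : ℝ := sInf (hitSetPos h f)

/-- The hitting time `τ₋ = sup {α ≤ 0 : f α ≤ h α}`. It is only used when the set is nonempty,
that is, when `τ₋ > -∞`. -/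
noncomputable def tauNeg (h : ℝ → EReal) (f : ℝ → ℝ) : ℝ := sSup (hitSetNeg h f)

open Classical in
/-- `exp (-τ₊ ξ² - f(τ₊) ξ) 1_{τ₊ < ∞}` along the path `f`. -/
noncomputable def weightPos (h : ℝ → EReal) (ξ : ℂ) (f : ℝ → ℝ) : ℂ :=
  if (hitSetPos h f).Nonempty then
    Complex.exp (-(tauPos h f : ℂ) * ξ ^ 2 - (f (tauPos h f) : ℂ) * ξ)
  else 0

open Classical in
/-- `exp (τ₋ η² + f(τ₋) η) 1_{τ₋ > -∞}` along the path `f`. -/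
noncomputable def weightNeg (h : ℝ → EReal) (η : ℂ) (f : ℝ → ℝ) : ℂ :=
  if (hitSetNeg h f).Nonempty then
    Complex.exp ((tauNeg h f : ℂ) * η ^ 2 + (f (tauNeg h f) : ℂ) * η)
  else 0

section
variable {Ω : Type*} [MeasurableSpace Ω]

/-- `E_{B(0) = s} [exp (-τ₊ ξ² - B(τ₊) ξ) 1_{τ₊ < ∞}]`; the Brownian motion started at `s` is
`s + B`, where `B` starts at `0`. -/
noncomputable def expectPos (B : ℝ → Ω → ℝ) (P : Measure Ω) (h : ℝ → EReal) (ξ : ℂ) (s : ℝ) : ℂ :=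
  ∫ ω, weightPos h ξ (fun t => s + B t ω) ∂P

/-- `E_{B(0) = s} [exp (τ₋ η² + B(τ₋) η) 1_{τ₋ > -∞}]`. -/
noncomputable def expectNeg (B : ℝ → Ω → ℝ) (P : Measure Ω) (h : ℝ → EReal) (η : ℂ) (s : ℝ) : ℂ :=
  ∫ ω, weightNeg h η (fun t => s + B t ω) ∂P

/-- The Brownian hitting kernel `χ_h(η, ξ)`. -/
noncomputable def chi (B : ℝ → Ω → ℝ) (P : Measure Ω) (h : ℝ → EReal) (η ξ : ℂ) : ℂ :=
  (∫ s : ℝ, Complex.exp (s * η) * expectPos B P h ξ s)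
    + (∫ s : ℝ, Complex.exp (-s * ξ) * expectNeg B P h η s)
    - ∫ s : ℝ, expectPos B P h ξ s * expectNeg B P h η s

/-- All expectations and all integrals in the definition of `χ_h(η, ξ)` converge absolutely. -/
structure ChiWellDefined (B : ℝ → Ω → ℝ) (P : Measure Ω) (h : ℝ → EReal) (η ξ : ℂ) : Prop where
  integrable_weightPos : ∀ s : ℝ, Integrable (fun ω => weightPos h ξ (fun t => s + B t ω)) P
  integrable_weightNeg : ∀ s : ℝ, Integrable (fun ω => weightNeg h η (fun t => s + B t ω)) P
  integrable_first : Integrable (fun s : ℝ => Complex.exp (s * η) * expectPos B P h ξ s)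
  integrable_second : Integrable (fun s : ℝ => Complex.exp (-s * ξ) * expectNeg B P h η s)
  integrable_third : Integrable (fun s : ℝ => expectPos B P h ξ s * expectNeg B P h η s)

end

end KPZ

/-!
The two halves of the Brownian path enter `χ_h` separately, and reversing time turns `τ₋` into `τ₊`
(`weightNeg_eq_weightPos`), so that everything reduces to `E(s) = E^+_ξ(s)`, here `stoppedExp`, for
a Brownian motion indexed by `ℝ≥0` with measurable marginals and continuous paths.

Write `X` for the path started at `s`, `ξ = -b + i y`, and let `h ≤ β` be `-∞` after time `L`.
For real `l` the process `exp (-l² t - l X_t)` is a martingale, and optional stopping at `τ₊`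
gives `E[exp (-l² τ₊ - l X(τ₊)) 1_{τ₊ < ∞}] ≤ exp (-l s)` (`lintegral_expMart_tauPos_le`). This one
inequality is used twice:
* with `l = -b` it bounds `|E(s)|` by `exp (L y² + b s)`, because the weight has modulus at most
  `exp (L y²) exp (-b² τ₊ + b X(τ₊))`;
* with `l = (s - β) / (2 L)`, for `s ≥ β`, it bounds the probability that `τ₊ < ∞` by
  `exp (-(s - β)² / (4 L))`, because `X(τ₊) ≤ β`, and then `|E(s)|` by `exp (L y² + b β)` times this
  probability.

With `a = Re η`, each of the three integrands of `χ_h` is thus at most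
`exp (β (a + b) + L (Im η)² + L (Im ξ)²)` times an envelope which is `exp ((a + b) (s - β))` for
`s ≤ β` and `exp (A (s - β) - (s - β)² / (4 L))` for `s > β`, where `A` is `a`, `b` or `0`. The
envelope has integral at most `1 / (a + b) + √(4 π L) exp (A² L)`. The sum of the three bounds is
below the claimed one even without the term in `L ^ (3 / 2)` (`envelope_sum_le`), since
`8 / (a + b) ≤ 2 / a + 2 / b` and since the factor `exp (a + b) ≥ 1 + (a + b)` gains an additive
constant `8`, which with `8 L` absorbs the multiple of `√L`.

The envelope is locally uniform in `(η, ξ)`. For fixed `s` the integrands are holomorphic, by a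
first use of domination under the expectation, and `analyticOnNhd_integral_of_dominated`, which
rests on Osgood's lemma, makes the three integrals jointly analytic.
-/

/-! ### Analyticity of dominated parametric integrals -/

open Metric Topology in
/-- Iterated integration of a continuous function on the torus `|z - z₀| = R`, `|w - w₀| = R`
against `dz dw`. -/
noncomputable def torusFunctional (z₀ w₀ : ℂ) {R : ℝ} (hR : 0 ≤ R) :
    C(sphere z₀ R × sphere w₀ R, ℂ) →L[ℂ] ℂ :=
  LinearMap.mkContinuous
    { toFun := fun g => ∫ θ in (0 : ℝ)..2 * Real.pi, ∫ φ in (0 : ℝ)..2 * Real.pi,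
        deriv (circleMap z₀ R) θ * (deriv (circleMap w₀ R) φ *
          g (⟨circleMap z₀ R θ, circleMap_mem_sphere z₀ hR θ⟩,
            ⟨circleMap w₀ R φ, circleMap_mem_sphere w₀ hR φ⟩))
      map_add' := by
        intro g₁ g₂
        have key : ∀ g : C(sphere z₀ R × sphere w₀ R, ℂ), Continuous (fun q : ℝ × ℝ =>
          deriv (circleMap z₀ R) q.1 * (deriv (circleMap w₀ R) q.2 *
          g (⟨circleMap z₀ R q.1, circleMap_mem_sphere z₀ hR q.1⟩,
            ⟨circleMap w₀ R q.2, circleMap_mem_sphere w₀ hR q.2⟩))) := by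
          intro g
          simp only [deriv_circleMap]
          fun_prop
        have h1 : ∀ g θ, IntervalIntegrable (fun φ => deriv (circleMap z₀ R) θ *
            (deriv (circleMap w₀ R) φ *
            (g : C(sphere z₀ R × sphere w₀ R, ℂ))
              (⟨circleMap z₀ R θ, circleMap_mem_sphere z₀ hR θ⟩,
            ⟨circleMap w₀ R φ, circleMap_mem_sphere w₀ hR φ⟩))) volume 0 (2 * Real.pi) :=
          fun g θ => ((key g).comp (Continuous.prodMk_right θ)).intervalIntegrable _ _
        rw [← intervalIntegral.integral_add]
        · congr 1
          ext θ
          rw [← intervalIntegral.integral_add (h1 g₁ θ) (h1 g₂ θ)]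
          congr 1
          ext φ
          simp only [ContinuousMap.add_apply]
          ring
        · exact (intervalIntegral.continuous_parametric_intervalIntegral_of_continuous'
            (key g₁) 0 (2 * Real.pi)).intervalIntegrable _ _
        · exact (intervalIntegral.continuous_parametric_intervalIntegral_of_continuous'
            (key g₂) 0 (2 * Real.pi)).intervalIntegrable _ _
      map_smul' := by
        intro c g
        simp only [RingHom.id_apply, smul_eq_mul]
        rw [← intervalIntegral.integral_const_mul]
        congr 1
        ext θ
        rw [← intervalIntegral.integral_const_mul]
        congr 1
        ext φ
        simp only [ContinuousMap.smul_apply, smul_eq_mul]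
        ring }
    (R * (R * |2 * Real.pi - 0|) * |2 * Real.pi - 0|) (by
      intro g
      calc _ ≤ (R * (R * ‖g‖) * |2 * Real.pi - 0|) * |2 * Real.pi - 0| := by
            refine intervalIntegral.norm_integral_le_of_norm_le_const fun θ _ => ?_
            refine intervalIntegral.norm_integral_le_of_norm_le_const fun φ _ => ?_
            simp only [deriv_circleMap, norm_mul, norm_circleMap_zero, Complex.norm_I, mul_one,
              abs_of_nonneg hR]
            gcongr
            exact g.norm_coe_le_norm _
        _ = _ := by ring)

open Metric Topology in
lemma torusFunctional_apply (z₀ w₀ : ℂ) {R : ℝ} (hR : 0 ≤ R)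
    (g : C(sphere z₀ R × sphere w₀ R, ℂ)) (G : ℂ → ℂ → ℂ) (hG : ∀ q, g q = G q.1 q.2) :
    torusFunctional z₀ w₀ hR g = ∮ z in C(z₀, R), ∮ w in C(w₀, R), G z w := by
  simp only [circleIntegral, ← intervalIntegral.integral_smul]
  simp [torusFunctional, hG]

open Metric Topology in
/-- **Osgood's lemma** in two variables. On a small torus the Cauchy formula, applied in each
variable, writes `f (z, w)` as a continuous linear functional of a product in the Banach algebra
of continuous functions on the torus, whose factors are inverses depending analytically on `z`
and on `w`. -/
theorem analyticOnNhd_prod_of_separately {f : ℂ × ℂ → ℂ} {U V : Set ℂ} (hU : IsOpen U)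
    (hV : IsOpen V) (hf : ContinuousOn f (U ×ˢ V))
    (h₁ : ∀ w ∈ V, DifferentiableOn ℂ (fun z => f (z, w)) U)
    (h₂ : ∀ z ∈ U, DifferentiableOn ℂ (fun w => f (z, w)) V) :
    AnalyticOnNhd ℂ f (U ×ˢ V) := by
  rintro ⟨z₀, w₀⟩ ⟨hz₀, hw₀⟩
  obtain ⟨R₁, hR₁, hRU⟩ := nhds_basis_closedBall.mem_iff.1 (hU.mem_nhds hz₀)
  obtain ⟨R₂, hR₂, hRV⟩ := nhds_basis_closedBall.mem_iff.1 (hV.mem_nhds hw₀)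
  obtain ⟨R, hR, hRle₁, hRle₂⟩ : ∃ R : ℝ, 0 < R ∧ R ≤ R₁ ∧ R ≤ R₂ :=
    ⟨min R₁ R₂, lt_min hR₁ hR₂, min_le_left _ _, min_le_right _ _⟩
  replace hRU := (closedBall_subset_closedBall hRle₁).trans hRU
  replace hRV := (closedBall_subset_closedBall hRle₂).trans hRV
  have hSU : sphere z₀ R ⊆ U := sphere_subset_closedBall.trans hRU
  have hSV : sphere w₀ R ⊆ V := sphere_subset_closedBall.trans hRV
  -- `a` and `b` are the coordinate functions of the torus, so `(a - z)⁻¹` and `(b - w)⁻¹` are the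
  -- Cauchy kernels as elements of the Banach algebra `E`
  let E := C(sphere z₀ R × sphere w₀ R, ℂ)
  let g : E := ⟨fun q => f (q.1, q.2), hf.comp_continuous (by fun_prop)
    fun q => ⟨hSU q.1.2, hSV q.2.2⟩⟩
  let a : E := ⟨fun q => q.1, by fun_prop⟩
  let b : E := ⟨fun q => q.2, by fun_prop⟩
  have ha : ∀ z ∈ ball z₀ R, IsUnit (a - algebraMap ℂ E z) := fun z hz =>
    (ContinuousMap.isUnit_iff_forall_ne_zero _).2 fun q hq => by
      have h1 : (q.1 : ℂ) = z := sub_eq_zero.1 hq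
      have h2 := q.1.2
      rw [mem_sphere, h1] at h2
      exact (mem_ball.1 hz).ne h2
  have hb : ∀ w ∈ ball w₀ R, IsUnit (b - algebraMap ℂ E w) := fun w hw =>
    (ContinuousMap.isUnit_iff_forall_ne_zero _).2 fun q hq => by
      have h1 : (q.2 : ℂ) = w := sub_eq_zero.1 hq
      have h2 := q.2.2
      rw [mem_sphere, h1] at h2
      exact (mem_ball.1 hw).ne h2
  have inv_apply : ∀ (e : E), IsUnit e → ∀ q, Ring.inverse e q = (e q)⁻¹ := by
    intro e he q
    have := congrArg (fun e' : E => e' q) (Ring.inverse_mul_cancel e he)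
    exact eq_inv_of_mul_eq_one_left this
  let Φ : ℂ × ℂ → ℂ := fun p => (2 * Real.pi * Complex.I)⁻¹ * ((2 * Real.pi * Complex.I)⁻¹ *
    torusFunctional z₀ w₀ hR.le
      (g * (Ring.inverse (a - algebraMap ℂ E p.1) * Ring.inverse (b - algebraMap ℂ E p.2))))
  have hΦ : AnalyticAt ℂ Φ (z₀, w₀) := by
    have hlin : ∀ z, AnalyticAt ℂ (fun z : ℂ => algebraMap ℂ E z) z := fun z =>
      (Algebra.linearMap ℂ E).toContinuousLinearMap.analyticAt z
    obtain ⟨ua, hua⟩ := ha z₀ (mem_ball_self hR)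
    obtain ⟨ub, hub⟩ := hb w₀ (mem_ball_self hR)
    have e1 : AnalyticAt ℂ (fun p : ℂ × ℂ => Ring.inverse (a - algebraMap ℂ E p.1)) (z₀, w₀) := by
      refine AnalyticAt.fun_comp (g := Ring.inverse) (hua ▸ analyticAt_inverse ua) ?_
      exact analyticAt_const.sub ((hlin z₀).fun_comp analyticAt_fst)
    have e2 : AnalyticAt ℂ (fun p : ℂ × ℂ => Ring.inverse (b - algebraMap ℂ E p.2)) (z₀, w₀) := by
      refine AnalyticAt.fun_comp (g := Ring.inverse) (hub ▸ analyticAt_inverse ub) ?_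
      exact analyticAt_const.sub ((hlin w₀).fun_comp analyticAt_snd)
    exact analyticAt_const.mul (analyticAt_const.mul
      (((torusFunctional z₀ w₀ hR.le).analyticAt _).fun_comp (analyticAt_const.mul (e1.mul e2))))
  refine hΦ.congr ?_
  have hpi : (2 * Real.pi * Complex.I : ℂ) ≠ 0 := Complex.two_pi_I_ne_zero
  filter_upwards [(isOpen_ball.prod isOpen_ball).mem_nhds
    (show (z₀, w₀) ∈ ball z₀ R ×ˢ ball w₀ R from ⟨mem_ball_self hR, mem_ball_self hR⟩)]
  rintro ⟨z, w⟩ ⟨hz, hw⟩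
  simp only at hz hw
  simp only [Φ]
  rw [torusFunctional_apply z₀ w₀ hR.le _
    (fun ζ ω => (ζ - z)⁻¹ • ((ω - w)⁻¹ • f (ζ, ω))) (fun q => by
      change g q * (Ring.inverse (a - algebraMap ℂ E z) q * Ring.inverse (b - algebraMap ℂ E w) q)
        = _
      rw [inv_apply _ (ha z hz), inv_apply _ (hb w hw)]
      change f (q.1, q.2) * (((q.1 : ℂ) - z)⁻¹ * ((q.2 : ℂ) - w)⁻¹) = _
      simp only [smul_eq_mul]
      ring)]
  have e1 : (∮ ζ in C(z₀, R), ∮ ω in C(w₀, R), (ζ - z)⁻¹ • ((ω - w)⁻¹ • f (ζ, ω)))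
      = ∮ ζ in C(z₀, R), (ζ - z)⁻¹ • ((2 * Real.pi * Complex.I) • f (ζ, w)) := by
    refine circleIntegral.integral_congr hR.le fun ζ hζ => ?_
    rw [circleIntegral.integral_smul, ((h₂ ζ (hSU hζ)).mono hRV).circleIntegral_sub_inv_smul hw]
  have e2 : (∮ ζ in C(z₀, R), (ζ - z)⁻¹ • ((2 * Real.pi * Complex.I) • f (ζ, w))) =
      (2 * Real.pi * Complex.I) • ((2 * Real.pi * Complex.I) • f (z, w)) :=
    (((h₁ w (hRV (ball_subset_closedBall hw))).mono hRU).const_smul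
      (2 * Real.pi * Complex.I)).circleIntegral_sub_inv_smul hz
  rw [e1, e2]
  simp only [smul_eq_mul]
  field_simp

open Metric Topology in
/-- An integral of functions holomorphic in the parameter, locally dominated, is holomorphic: the
Cauchy estimate turns the domination of the functions into a domination of their derivatives. -/
theorem differentiableOn_integral_of_dominated {α : Type*} [MeasurableSpace α] {μ : Measure α}
    {F : ℂ → α → ℂ} {U : Set ℂ} (hU : IsOpen U)
    (hmeas : ∀ z ∈ U, AEStronglyMeasurable (F z) μ)
    (hdiff : ∀ x, DifferentiableOn ℂ (fun z => F z x) U)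
    (hdom : ∀ z₀ ∈ U, ∃ g : α → ℝ, Integrable g μ ∧ ∀ᶠ z in 𝓝 z₀, ∀ x, ‖F z x‖ ≤ g x) :
    DifferentiableOn ℂ (fun z => ∫ x, F z x ∂μ) U := by
  intro z₀ hz₀
  refine DifferentiableAt.differentiableWithinAt ?_
  obtain ⟨g, hg, hgb⟩ := hdom z₀ hz₀
  obtain ⟨r, hr, hrb⟩ := nhds_basis_closedBall.mem_iff.1 (inter_mem hgb (hU.mem_nhds hz₀))
  -- the Cauchy estimate is applied on circles of radius `r / 2` centred in `ball z₀ (r / 2)`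
  have hsub : ∀ z ∈ ball z₀ (r / 2), closedBall z (r / 2) ⊆ closedBall z₀ r := fun z hz =>
    closedBall_subset_closedBall' (by have := mem_ball.1 hz; linarith)
  have hderiv : ∀ x, ∀ z ∈ ball z₀ (r / 2), HasDerivAt (fun z => F z x)
      (deriv (fun z => F z x) z) z := fun x z hz =>
    ((hdiff x).differentiableAt (hU.mem_nhds (hrb (hsub z hz
      (mem_closedBall_self (by positivity)))).2)).hasDerivAt
  have hz₀r : z₀ ∈ ball z₀ (r / 2) := mem_ball_self (by positivity)
  refine (hasDerivAt_integral_of_dominated_loc_of_deriv_le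
    (F' := fun z x => deriv (fun z => F z x) z) (bound := fun x => g x / (r / 2))
    (ball_mem_nhds z₀ (half_pos hr)) ?_ ?_ ?_ ?_ ?_ ?_).2.differentiableAt
  · filter_upwards [hU.mem_nhds hz₀] with z hz using hmeas z hz
  · exact hg.mono' (hmeas z₀ hz₀) (ae_of_all _ fun x => (mem_of_mem_nhds hgb) x)
  · -- the derivative is a limit of difference quotients along a sequence
    let u : ℕ → ℂ := fun n => ((r / 2 / (n + 2) : ℝ) : ℂ)
    have hu0 : ∀ n, u n ≠ 0 := fun n => by
      simp only [u]
      exact_mod_cast (show (r / 2 / (n + 2) : ℝ) ≠ 0 by positivity)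
    have hlim : Tendsto u atTop (𝓝 0) := by
      have : Tendsto (fun n : ℕ => (r / 2 / (n + 2) : ℝ)) atTop (𝓝 0) :=
        tendsto_const_nhds.div_atTop
          (tendsto_atTop_add_const_right _ _ tendsto_natCast_atTop_atTop)
      have h2 := (Complex.continuous_ofReal.tendsto 0).comp this
      simpa only [Complex.ofReal_zero, Function.comp_def] using h2
    have hmem : ∀ n, z₀ + u n ∈ U := fun n => by
      refine (hrb ?_).2
      simp only [mem_closedBall, dist_self_add_left, u, Complex.norm_real, Real.norm_eq_abs]
      rw [abs_of_pos (by positivity)]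
      rw [div_le_iff₀ (by positivity)]
      have : (0 : ℝ) ≤ n := by positivity
      nlinarith
    refine aestronglyMeasurable_of_tendsto_ae atTop
      (f := fun n x => (u n)⁻¹ • (F (z₀ + u n) x - F z₀ x))
      (fun n => (((hmeas _ (hmem n)).sub (hmeas z₀ hz₀)).const_smul (u n)⁻¹)) ?_
    refine ae_of_all _ fun x => ?_
    exact (hderiv x z₀ hz₀r).tendsto_slope_zero.comp
      (tendsto_nhdsWithin_iff.2 ⟨hlim, Eventually.of_forall hu0⟩)
  · refine ae_of_all _ fun x z hz => ?_
    refine Complex.norm_deriv_le_of_forall_mem_sphere_norm_le (half_pos hr) ?_ ?_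
    · refine DifferentiableOn.diffContOnCl ((hdiff x).mono ?_)
      rw [closure_ball _ (half_pos hr).ne']
      exact fun w hw => (hrb (hsub z hz hw)).2
    · exact fun w hw => (hrb (hsub z hz (sphere_subset_closedBall hw))).1 x
  · exact hg.div_const _
  · exact ae_of_all _ fun x z hz => hderiv x z hz

open Metric Topology in
/-- The two-variable version of `differentiableOn_integral_of_dominated`, obtained from it by
Osgood's lemma, the joint continuity being dominated convergence. -/
theorem analyticOnNhd_integral_of_dominated {α : Type*} [MeasurableSpace α] {μ : Measure α}
    {F : ℂ × ℂ → α → ℂ} {U V : Set ℂ} (hU : IsOpen U) (hV : IsOpen V)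
    (hmeas : ∀ p ∈ U ×ˢ V, AEStronglyMeasurable (F p) μ)
    (hdiff : ∀ x, DifferentiableOn ℂ (fun p => F p x) (U ×ˢ V))
    (hdom : ∀ p₀ ∈ U ×ˢ V, ∃ g : α → ℝ, Integrable g μ ∧ ∀ᶠ p in 𝓝 p₀, ∀ x, ‖F p x‖ ≤ g x) :
    AnalyticOnNhd ℂ (fun p => ∫ x, F p x ∂μ) (U ×ˢ V) := by
  refine analyticOnNhd_prod_of_separately hU hV ?_ ?_ ?_
  · intro p₀ hp₀
    obtain ⟨g, hg, hgb⟩ := hdom p₀ hp₀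
    have hn := (hU.prod hV).mem_nhds hp₀
    refine (continuousAt_of_dominated (bound := g) ?_ ?_ hg ?_).continuousWithinAt
    · filter_upwards [hn] with p hp using hmeas p hp
    · filter_upwards [hgb] with p hp using ae_of_all _ hp
    · exact ae_of_all _ fun x => ((hdiff x).differentiableAt hn).continuousAt
  · intro w hw
    refine differentiableOn_integral_of_dominated hU (fun z hz => hmeas _ ⟨hz, hw⟩) (fun x => ?_) ?_
    · exact (hdiff x).comp (f := fun z => (z, w)) (by fun_prop) fun z hz => ⟨hz, hw⟩
    · intro z₀ hz₀
      obtain ⟨g, hg, hgb⟩ := hdom (z₀, w) ⟨hz₀, hw⟩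
      exact ⟨g, hg, (Continuous.prodMk_left w).continuousAt.eventually hgb⟩
  · intro z hz
    refine differentiableOn_integral_of_dominated hV (fun w hw => hmeas _ ⟨hz, hw⟩) (fun x => ?_) ?_
    · exact (hdiff x).comp (f := fun w => (z, w)) (by fun_prop) fun w hw => ⟨hz, hw⟩
    · intro w₀ hw₀
      obtain ⟨g, hg, hgb⟩ := hdom (z, w₀) ⟨hz, hw₀⟩
      exact ⟨g, hg, (Continuous.prodMk_right z).continuousAt.eventually hgb⟩

namespace KPZ

open Topology
open scoped ENNReal

/-! ### Hitting times of a hypograph -/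

lemma isClosed_setOf_coe_le {h : ℝ → EReal} (hh : UpperSemicontinuous h) {f : ℝ → ℝ}
    (hf : Continuous f) : IsClosed {α | (f α : EReal) ≤ h α} := by
  rw [← isOpen_compl_iff, isOpen_iff_mem_nhds]
  intro α hα
  have hα : h α < f α := not_le.1 hα
  obtain ⟨c, h1, h2⟩ := EReal.lt_iff_exists_real_btwn.1 hα
  filter_upwards [hh α c h1, hf.continuousAt.eventually (lt_mem_nhds (EReal.coe_lt_coe_iff.1 h2))]
    with x hx1 hx2
  exact not_le.2 (hx1.trans (EReal.coe_lt_coe_iff.2 hx2))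

lemma isClosed_hitSetPos {h : ℝ → EReal} (hh : UpperSemicontinuous h) {f : ℝ → ℝ}
    (hf : Continuous f) : IsClosed (hitSetPos h f) :=
  isClosed_Ici.inter (isClosed_setOf_coe_le hh hf)

lemma bddBelow_hitSetPos (h : ℝ → EReal) (f : ℝ → ℝ) : BddBelow (hitSetPos h f) :=
  ⟨0, fun _ hα => hα.1⟩

lemma tauPos_mem {h : ℝ → EReal} (hh : UpperSemicontinuous h) {f : ℝ → ℝ}
    (hf : Continuous f) (hne : (hitSetPos h f).Nonempty) : tauPos h f ∈ hitSetPos h f :=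
  (isClosed_hitSetPos hh hf).csInf_mem hne (bddBelow_hitSetPos h f)

/-- The path `f` meets the hypograph of `h` during `[0, t]`. -/
def HitBy (h : ℝ → EReal) (f : ℝ → ℝ) (t : ℝ) : Prop :=
  ∃ α ∈ Set.Icc 0 t, (f α : EReal) ≤ h α

lemma HitBy.nonempty {h : ℝ → EReal} {f : ℝ → ℝ} {t : ℝ} (H : HitBy h f t) :
    (hitSetPos h f).Nonempty :=
  let ⟨α, hα, hle⟩ := H
  ⟨α, hα.1, hle⟩

lemma hitBy_iff {h : ℝ → EReal} (hh : UpperSemicontinuous h) {f : ℝ → ℝ} (hf : Continuous f)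
    {t : ℝ} : HitBy h f t ↔ (hitSetPos h f).Nonempty ∧ tauPos h f ≤ t := by
  constructor
  · exact fun H => ⟨H.nonempty, let ⟨α, hα, hle⟩ := H
      (csInf_le (bddBelow_hitSetPos h f) ⟨hα.1, hle⟩).trans hα.2⟩
  · rintro ⟨hne, hle⟩
    have := tauPos_mem hh hf hne
    exact ⟨_, ⟨this.1, hle⟩, this.2⟩

/-- Hitting the hypograph during `[0, t]` only involves countably many values of the path: by
compactness and semicontinuity it is enough that, for every `n`, the path at some time `q n` of a
dense set is below `h` up to an error `1 / (n + 1)` in time and in height. -/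
lemma hitBy_iff_dense {h : ℝ → EReal} (hh : UpperSemicontinuous h) {f : ℝ → ℝ}
    (hf : Continuous f) {t : ℝ} {d : ℕ → Set.Icc 0 t} (hd : DenseRange d) :
    HitBy h f t ↔ ∀ n : ℕ, ∃ k : ℕ, ∃ α ∈ Set.Icc 0 t,
      |α - d k| < 1 / ((n : ℝ) + 1) ∧ ((f (d k) - 1 / ((n : ℝ) + 1) : ℝ) : EReal) < h α := by
  constructor
  · rintro ⟨α, hα, hle⟩ n
    have hpos : 0 < 1 / ((n : ℝ) + 1) := by positivity
    have hopen : IsOpen {q : Set.Icc 0 t | |α - q| < 1 / ((n : ℝ) + 1) ∧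
        f q - 1 / ((n : ℝ) + 1) < f α} := by
      refine IsOpen.and (isOpen_lt ?_ ?_) (isOpen_lt ?_ ?_) <;> fun_prop
    obtain ⟨k, hk⟩ := hd.exists_mem_open hopen ⟨⟨α, hα⟩, by simpa using by positivity,
      by simpa using by positivity⟩
    exact ⟨k, α, hα, hk.1, (EReal.coe_lt_coe_iff.2 hk.2).trans_le hle⟩
  · intro H
    choose k α hα hdist hlt using H
    obtain ⟨a, ha, φ, hφ, hlim⟩ := isCompact_Icc.tendsto_subseq hα
    refine ⟨a, ha, ?_⟩
    by_contra hcon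
    obtain ⟨c, h1, h2⟩ := EReal.lt_iff_exists_real_btwn.1 (not_le.1 hcon)
    have hzero : Tendsto (fun n => 1 / ((φ n : ℝ) + 1)) atTop (𝓝 0) :=
      (tendsto_one_div_add_atTop_nhds_zero_nat (𝕜 := ℝ)).comp hφ.tendsto_atTop
    have hq : Tendsto (fun n => (d (k (φ n)) : ℝ)) atTop (𝓝 a) := by
      have h0 : Tendsto (fun n => α (φ n) - d (k (φ n))) atTop (𝓝 0) :=
        squeeze_zero_norm (fun n => (hdist (φ n)).le) hzero
      simpa using hlim.sub h0
    have hfq : Tendsto (fun n => f (d (k (φ n))) - 1 / ((φ n : ℝ) + 1)) atTop (𝓝 (f a)) := by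
      simpa using ((hf.tendsto a).comp hq).sub hzero
    obtain ⟨n, hn1, hn2⟩ := ((hlim.eventually (hh a c h1)).and
      (hfq.eventually (lt_mem_nhds (EReal.coe_lt_coe_iff.1 h2)))).exists
    exact absurd (hlt (φ n)) (not_lt.2 (hn1.le.trans (EReal.coe_le_coe_iff.2 hn2.le)))

lemma measurableSet_hitBy {Ω : Type*} {m : MeasurableSpace Ω} {h : ℝ → EReal}
    (hh : UpperSemicontinuous h) {X : ℝ → Ω → ℝ} (hX : ∀ ω, Continuous (X · ω)) {t : ℝ}
    (hm : ∀ r ∈ Set.Icc 0 t, Measurable (X r)) : MeasurableSet {ω | HitBy h (X · ω) t} := by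
  rcases (Set.Icc (0 : ℝ) t).eq_empty_or_nonempty with he | hne
  · simp [HitBy, he]
  have := hne.to_subtype
  have hrw : {ω | HitBy h (X · ω) t} = ⋂ n : ℕ, ⋃ k : ℕ,
      X (TopologicalSpace.denseSeq (Set.Icc (0 : ℝ) t) k) ⁻¹'
        ⋃ α ∈ {α ∈ Set.Icc 0 t | |α - TopologicalSpace.denseSeq (Set.Icc (0 : ℝ) t) k|
          < 1 / ((n : ℝ) + 1)}, {x | ((x - 1 / ((n : ℝ) + 1) : ℝ) : EReal) < h α} := by
    ext ω
    simp only [Set.mem_ofPred_eq, Set.mem_iInter, Set.mem_iUnion, Set.mem_preimage]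
    rw [hitBy_iff_dense hh (hX ω) (TopologicalSpace.denseRange_denseSeq _)]
    simp only [exists_prop, and_assoc]
  rw [hrw]
  refine MeasurableSet.iInter fun n => MeasurableSet.iUnion fun k =>
    hm _ (TopologicalSpace.denseSeq (Set.Icc (0 : ℝ) t) k).2 (IsOpen.measurableSet ?_)
  refine isOpen_biUnion fun α _ => isOpen_lt ?_ continuous_const
  exact continuous_coe_real_ereal.comp (by fun_prop)

lemma measurableSet_hitSetPos_nonempty {Ω : Type*} {m : MeasurableSpace Ω} {h : ℝ → EReal}
    (hh : UpperSemicontinuous h) {X : ℝ → Ω → ℝ} (hX : ∀ ω, Continuous (X · ω))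
    (hm : ∀ r, Measurable (X r)) : MeasurableSet {ω | (hitSetPos h (X · ω)).Nonempty} := by
  have : {ω | (hitSetPos h (X · ω)).Nonempty} = ⋃ n : ℕ, {ω | HitBy h (X · ω) n} := by
    ext ω
    simp only [Set.mem_ofPred_eq, Set.mem_iUnion]
    refine ⟨fun ⟨α, h0, hle⟩ => ?_, fun ⟨n, hn⟩ => hn.nonempty⟩
    obtain ⟨n, hn⟩ := exists_nat_ge α
    exact ⟨n, α, ⟨h0, hn⟩, hle⟩
  rw [this]
  exact MeasurableSet.iUnion fun n => measurableSet_hitBy hh hX fun r _ => hm r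

lemma measurable_tauPos {Ω : Type*} {m : MeasurableSpace Ω} {h : ℝ → EReal}
    (hh : UpperSemicontinuous h) {X : ℝ → Ω → ℝ} (hX : ∀ ω, Continuous (X · ω))
    (hm : ∀ r, Measurable (X r)) : Measurable fun ω => tauPos h (X · ω) := by
  refine measurable_of_Iic fun t => ?_
  have hne := measurableSet_hitSetPos_nonempty hh hX hm
  -- the infimum of the empty set is `0`
  have : (fun ω => tauPos h (X · ω)) ⁻¹' Set.Iic t = {ω | HitBy h (X · ω) t} ∪
      ({ω | (hitSetPos h (X · ω)).Nonempty}ᶜ ∩ {_ω | 0 ≤ t}) := by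
    ext ω
    simp only [Set.mem_preimage, Set.mem_Iic, Set.mem_union, Set.mem_ofPred_eq, Set.mem_inter_iff,
      Set.mem_compl_iff, hitBy_iff hh (hX ω)]
    by_cases hω : (hitSetPos h (X · ω)).Nonempty
    · simp [hω]
    · simp [tauPos, Set.not_nonempty_iff_eq_empty.1 hω]
  rw [this]
  exact (measurableSet_hitBy hh hX fun r _ => hm r).union (hne.compl.inter (MeasurableSet.const _))

lemma measurable_weightPos {Ω : Type*} {m : MeasurableSpace Ω} {h : ℝ → EReal}
    (hh : UpperSemicontinuous h) {X : ℝ → Ω → ℝ} (hX : ∀ ω, Continuous (X · ω))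
    (hm : ∀ r, Measurable (X r)) (ξ : ℂ) : Measurable fun ω => weightPos h ξ (X · ω) := by
  have hτ := measurable_tauPos hh hX hm
  have hXτ : Measurable fun ω => X (tauPos h (X · ω)) ω :=
    (measurable_uncurry_of_continuous_of_measurable hX hm).comp (hτ.prodMk measurable_id)
  refine Measurable.ite (measurableSet_hitSetPos_nonempty hh hX hm) ?_ measurable_const
  exact Complex.measurable_exp.comp (((Complex.measurable_ofReal.comp hτ).neg.mul_const _).sub
    ((Complex.measurable_ofReal.comp hXτ).mul_const _))

/-- Only the path at nonnegative times matters. -/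
lemma weightPos_congr {h : ℝ → EReal} {ξ : ℂ} {f g : ℝ → ℝ} (hfg : ∀ t, 0 ≤ t → f t = g t) :
    weightPos h ξ f = weightPos h ξ g := by
  have hset : hitSetPos h f = hitSetPos h g := by
    ext α
    simp only [hitSetPos, Set.mem_ofPred_eq]
    exact and_congr_right fun hα => by rw [hfg α hα]
  have hτ : tauPos h f = tauPos h g := by rw [tauPos, hset, tauPos]
  have h0 : 0 ≤ tauPos h g := Real.sInf_nonneg fun _ hα => hα.1
  rw [weightPos, weightPos, hset, hτ, hfg _ h0]

open Pointwise in
/-- Reversing time turns the hitting time `τ₋` into `τ₊`. -/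
lemma weightNeg_eq_weightPos (h : ℝ → EReal) (η : ℂ) (f : ℝ → ℝ) :
    weightNeg h η f = weightPos (fun x => h (-x)) (-η) (fun t => f (-t)) := by
  have hset : hitSetPos (fun x => h (-x)) (fun t => f (-t)) = -hitSetNeg h f := by
    ext α
    simp [hitSetPos, hitSetNeg]
  have hτ : tauPos (fun x => h (-x)) (fun t => f (-t)) = -tauNeg h f := by
    rw [tauPos, hset, Real.sInf_def, neg_neg, tauNeg]
  have hne : (hitSetPos (fun x => h (-x)) (fun t => f (-t))).Nonempty ↔
      (hitSetNeg h f).Nonempty := by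
    rw [hset]
    exact Set.nonempty_neg
  by_cases H : (hitSetNeg h f).Nonempty
  · rw [weightNeg, weightPos, if_pos H, if_pos (hne.2 H), hτ]
    simp
  · rw [weightNeg, weightPos, if_neg H, if_neg (mt hne.1 H)]

lemma tauPos_le {h : ℝ → EReal} (hh : UpperSemicontinuous h) {f : ℝ → ℝ}
    (hf : Continuous f) {L : ℝ} (hL : ∀ x, L < x → h x = ⊥)
    (hne : (hitSetPos h f).Nonempty) : tauPos h f ≤ L := by
  by_contra hcon
  have := (tauPos_mem hh hf hne).2
  rw [hL _ (not_le.1 hcon)] at this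
  exact absurd (le_bot_iff.1 this) (EReal.coe_ne_bot _)

/-- The modulus of the weight is controlled by a real exponential martingale at the hitting
time. -/
lemma norm_weightPos_le {h : ℝ → EReal} (hh : UpperSemicontinuous h) {f : ℝ → ℝ}
    (hf : Continuous f) {L : ℝ} (hL : ∀ x, L < x → h x = ⊥) (ξ : ℂ)
    (hne : (hitSetPos h f).Nonempty) :
    ‖weightPos h ξ f‖ ≤ Real.exp (L * ξ.im ^ 2) *
      Real.exp (-ξ.re ^ 2 * tauPos h f - ξ.re * f (tauPos h f)) := by
  have hτL := tauPos_le hh hf hL hne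
  rw [weightPos, if_pos hne, Complex.norm_exp, ← Real.exp_add]
  refine Real.exp_le_exp.2 ?_
  have : (-(tauPos h f : ℂ) * ξ ^ 2 - (f (tauPos h f) : ℂ) * ξ).re
      = -tauPos h f * (ξ.re ^ 2 - ξ.im ^ 2) - f (tauPos h f) * ξ.re := by
    simp [sq]
  rw [this]
  nlinarith [mul_le_mul_of_nonneg_right hτL (sq_nonneg ξ.im)]

/-! ### Brownian motion and its exponential martingale -/

/-- A pre-Brownian motion all of whose paths are continuous and all of whose marginals are
measurable; `IsBrownianReal` only asks for this almost everywhere. -/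
structure IsRegularBrownian {Ω : Type*} [MeasurableSpace Ω] (W : ℝ≥0 → Ω → ℝ) (P : Measure Ω) :
    Prop where
  isPreBrownianReal : IsPreBrownianReal W P
  continuous_path : ∀ ω, Continuous (W · ω)
  measurable_eval : ∀ t, Measurable (W t)


variable {Ω : Type*} [mΩ : MeasurableSpace Ω] {P : Measure Ω} {W : ℝ≥0 → Ω → ℝ}

lemma exists_isRegularBrownian (hW : IsBrownianReal W P) :
    ∃ W', IsRegularBrownian W' P ∧ ∀ᵐ ω ∂P, ∀ t, W t ω = W' t ω := by
  let d := TopologicalSpace.denseSeq ℝ≥0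
  have hm : ∀ t, AEMeasurable (W t) P := hW.toIsPreBrownianReal.aemeasurable
  have hae : ∀ᵐ ω ∂P, Continuous (W · ω) ∧ ∀ n, W (d n) ω = (hm (d n)).mk _ ω :=
    hW.cont.and (ae_all_iff.2 fun n => (hm (d n)).ae_eq_mk)
  obtain ⟨N, hN, hNm, hN0⟩ := exists_measurable_superset_of_null (ae_iff.1 hae)
  have hNc : ∀ ω ∈ Nᶜ, Continuous (W · ω) ∧ ∀ n, W (d n) ω = (hm (d n)).mk _ ω :=
    fun ω hω => not_not.1 fun hcon => hω (hN hcon)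
  let W' : ℝ≥0 → Ω → ℝ := fun t => Nᶜ.indicator (W t)
  have hcont : ∀ ω, Continuous (W' · ω) := fun ω => by
    by_cases hω : ω ∈ Nᶜ
    · simpa only [W', Set.indicator_of_mem hω] using (hNc ω hω).1
    · simpa only [W', Set.indicator_of_notMem hω] using continuous_const
  have heq : ∀ᵐ ω ∂P, ∀ t, W t ω = W' t ω := by
    filter_upwards [measure_eq_zero_iff_ae_notMem.1 hN0] with ω hω t
    exact (Set.indicator_of_mem (s := Nᶜ) hω (W t)).symm
  refine ⟨W', ⟨hW.toIsPreBrownianReal.congr fun t => heq.mono fun ω hω => hω t, hcont, ?_⟩, heq⟩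
  intro t
  have hd : ∀ n, Measurable (W' (d n)) := fun n => by
    have : W' (d n) = Nᶜ.indicator ((hm (d n)).mk _) := by
      ext ω
      by_cases hω : ω ∈ Nᶜ
      · simp only [W', Set.indicator_of_mem hω, (hNc ω hω).2 n]
      · simp only [W', Set.indicator_of_notMem hω]
    rw [this]
    exact (hm (d n)).measurable_mk.indicator hNm.compl
  obtain ⟨u, hu, hlim⟩ := mem_closure_iff_seq_limit.1
    (TopologicalSpace.denseRange_denseSeq ℝ≥0 t)
  choose k hk using hu
  refine measurable_of_tendsto_metrizable (f := fun n => W' (d (k n))) (fun n => hd (k n)) ?_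
  rw [tendsto_pi_nhds]
  intro ω
  have := ((hcont ω).tendsto t).comp hlim
  refine this.congr fun n => ?_
  simp only [Function.comp, ← hk n]
  rfl

/-- The path of diffusivity `2` started at `s` built from a standard Brownian motion. At negative
times it is frozen, which plays no role for hitting times `≥ 0`. -/
noncomputable def bmPath {Ω : Type*} (W : ℝ≥0 → Ω → ℝ) (s t : ℝ) (ω : Ω) : ℝ :=
  s + √2 * W t.toNNReal ω

/-- The exponential martingale `exp (-l² t - l X_t)` of the path `X = bmPath W s`. -/
noncomputable def expMart {Ω : Type*} (W : ℝ≥0 → Ω → ℝ) (s l t : ℝ) (ω : Ω) : ℝ :=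
  Real.exp (-l ^ 2 * t - l * bmPath W s t ω)

/-- The `σ`-algebra generated by the values of the process up to time `t`. -/
@[reducible] def pastSigma {Ω : Type*} (W : ℝ≥0 → Ω → ℝ) (t : ℝ≥0) : MeasurableSpace Ω :=
  MeasurableSpace.comap (fun ω (r : Set.Iic t) => W r ω) inferInstance

lemma IsRegularBrownian.pastSigma_le (hW : IsRegularBrownian W P) (t : ℝ≥0) :
    pastSigma W t ≤ mΩ :=
  (measurable_pi_lambda (fun ω (r : Set.Iic t) => W r ω)
    fun r => hW.measurable_eval r).comap_le

lemma measurable_pastSigma {Ω : Type*} (W : ℝ≥0 → Ω → ℝ) {r t : ℝ≥0} (hr : r ≤ t) :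
    Measurable[pastSigma W t] (W r) :=
  (measurable_pi_apply (⟨r, hr⟩ : Set.Iic t)).comp
    (comap_measurable (fun ω (r : Set.Iic t) => W r ω))

lemma pastSigma_mono {Ω : Type*} (W : ℝ≥0 → Ω → ℝ) : Monotone (pastSigma W) := by
  intro t t' htt
  refine Measurable.comap_le ?_
  exact @measurable_pi_lambda _ _ _ (pastSigma W t') _ _
    fun r => measurable_pastSigma W (le_trans r.2 htt)

lemma measurable_bmPath_pastSigma {Ω : Type*} (W : ℝ≥0 → Ω → ℝ) (s : ℝ) {r : ℝ} {t : ℝ≥0}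
    (hr : r ≤ t) :
    Measurable[pastSigma W t] (bmPath W s r) :=
  ((measurable_pastSigma W (Real.toNNReal_le_iff_le_coe.2 hr)).const_mul _).const_add _

lemma IsRegularBrownian.measurable_bmPath (hW : IsRegularBrownian W P) (s r : ℝ) :
    Measurable (bmPath W s r) :=
  ((hW.measurable_eval _).const_mul _).const_add _

lemma IsRegularBrownian.continuous_bmPath (hW : IsRegularBrownian W P) (s : ℝ) (ω : Ω) :
    Continuous (bmPath W s · ω) := by
  have := hW.continuous_path ω
  unfold bmPath
  fun_prop

lemma measurable_expMart_pastSigma {Ω : Type*} (W : ℝ≥0 → Ω → ℝ) (s l : ℝ) (t : ℝ≥0) :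
    Measurable[pastSigma W t] (expMart W s l t) :=
  Real.measurable_exp.comp
    (((measurable_bmPath_pastSigma W s le_rfl).const_mul l).const_sub _)

lemma IsRegularBrownian.lintegral_exp_increment (hW : IsRegularBrownian W P) (l : ℝ) (t u : ℝ≥0) :
    ∫⁻ ω, ENNReal.ofReal (Real.exp (-l ^ 2 * u - l * (√2 * (W (t + u) ω - W t ω)))) ∂P = 1 := by
  have hlaw := (hW.isPreBrownianReal.shift t).hasLaw_eval u
  have h1 : ∫ ω, Real.exp ((-l * √2) * (W (t + u) ω - W t ω)) ∂P = Real.exp (l ^ 2 * u) := by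
    have := mgf_gaussianReal hlaw.map_eq (-l * √2)
    rw [mgf] at this
    rw [this]
    congr 1
    have h2 : (√2 : ℝ) ^ 2 = 2 := Real.sq_sqrt (by norm_num)
    rw [mul_pow, h2]
    ring
  have hint : Integrable (fun ω => Real.exp ((-l * √2) * (W (t + u) ω - W t ω))) P := by
    by_contra hcon
    rw [integral_undef hcon] at h1
    exact (Real.exp_pos _).ne h1
  have h3 : (fun ω => Real.exp (-l ^ 2 * u - l * (√2 * (W (t + u) ω - W t ω)))) =
      fun ω => Real.exp (-l ^ 2 * u) * Real.exp ((-l * √2) * (W (t + u) ω - W t ω)) := by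
    ext ω
    rw [← Real.exp_add]
    congr 1
    ring
  rw [← ofReal_integral_eq_lintegral_ofReal (by rw [h3]; exact hint.const_mul _)
    (ae_of_all _ fun ω => (Real.exp_pos _).le), h3, integral_const_mul, h1, ← Real.exp_add]
  simp

/-- The martingale property of `expMart`, tested on an event of the past. -/
lemma IsRegularBrownian.setLIntegral_expMart (hW : IsRegularBrownian W P) (s l : ℝ) {t T : ℝ≥0}
    (htT : t ≤ T) {A : Set Ω} (hA : MeasurableSet[pastSigma W t] A) :
    ∫⁻ ω in A, ENNReal.ofReal (expMart W s l t ω) ∂P =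
      ∫⁻ ω in A, ENNReal.ofReal (expMart W s l T ω) ∂P := by
  have hA' : MeasurableSet A := hW.pastSigma_le t A hA
  obtain ⟨u, rfl⟩ := exists_add_of_le htT
  have hfac : ∀ ω, ENNReal.ofReal (expMart W s l ((t + u : ℝ≥0) : ℝ) ω) =
      ENNReal.ofReal (expMart W s l t ω) * ENNReal.ofReal
        (Real.exp (-l ^ 2 * u - l * (√2 * (W (t + u) ω - W t ω)))) := by
    intro ω
    rw [expMart, expMart, ← ENNReal.ofReal_mul (Real.exp_pos _).le, ← Real.exp_add]
    congr 2
    simp only [bmPath, Real.toNNReal_coe]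
    rw [NNReal.coe_add]
    ring
  simp_rw [hfac]
  rw [← lintegral_indicator hA', ← lintegral_indicator hA']
  simp_rw [Set.indicator_mul_left]
  have hind := hW.isPreBrownianReal.indepFun_shift t
  rw [IndepFun_iff_Indep] at hind
  have hle : MeasurableSpace.comap (fun ω (r : ℝ≥0) => W (t + r) ω - W t ω) inferInstance ≤ mΩ :=
    (measurable_pi_lambda (fun ω (r : ℝ≥0) => W (t + r) ω - W t ω)
      fun r => (hW.measurable_eval _).sub (hW.measurable_eval _)).comap_le
  rw [lintegral_mul_eq_lintegral_mul_lintegral_of_independent_measurableSpace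
    (hW.pastSigma_le t) hle hind.symm, hW.lintegral_exp_increment l t u, mul_one]
  · exact Measurable.indicator (m := pastSigma W t)
      (ENNReal.measurable_ofReal.comp (measurable_expMart_pastSigma W s l t)) hA
  · have hm : Measurable[MeasurableSpace.comap (fun ω (r : ℝ≥0) => W (t + r) ω - W t ω)
        inferInstance] (fun ω => W (t + u) ω - W t ω) :=
      (measurable_pi_apply u).comp (comap_measurable (fun ω (r : ℝ≥0) => W (t + r) ω - W t ω))
    exact ENNReal.measurable_ofReal.comp (Real.measurable_exp.comp
      (((hm.const_mul _).const_mul _).const_sub _))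

lemma IsRegularBrownian.lintegral_expMart (hW : IsRegularBrownian W P) (s l : ℝ) (T : ℝ≥0) :
    ∫⁻ ω, ENNReal.ofReal (expMart W s l T ω) ∂P = ENNReal.ofReal (Real.exp (-l * s)) := by
  have hprob : IsProbabilityMeasure P :=
    hW.isPreBrownianReal.isGaussianProcess.isProbabilityMeasure
  have h := hW.setLIntegral_expMart s l (zero_le (a := T)) (A := Set.univ) MeasurableSet.univ
  rw [setLIntegral_univ, setLIntegral_univ] at h
  rw [← h]
  have h0 : ∀ᵐ ω ∂P, ENNReal.ofReal (expMart W s l (0 : ℝ≥0) ω) =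
      ENNReal.ofReal (Real.exp (-l * s)) := by
    filter_upwards [hW.isPreBrownianReal.eval_zero_ae_eq_zero] with ω hω
    simp [expMart, bmPath, hω]
  rw [lintegral_congr_ae h0]
  simp

/-- **Optional stopping inequality** for the exponential martingale at the hitting time of the
hypograph of `h`. The hitting time is approximated from above by a time taking finitely many
values, for which the martingale property applies on each event where the value is fixed; Fatou's
lemma and continuity of the paths give the limit. -/
theorem IsRegularBrownian.lintegral_expMart_tauPos_le (hW : IsRegularBrownian W P) {h : ℝ → EReal}
    (hh : UpperSemicontinuous h) {L : ℝ} (hL0 : 0 < L) (hL : ∀ x, L < x → h x = ⊥) (s l : ℝ) :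
    ∫⁻ ω in {ω | (hitSetPos h (bmPath W s · ω)).Nonempty},
      ENNReal.ofReal (expMart W s l (tauPos h (bmPath W s · ω)) ω) ∂P ≤
      ENNReal.ofReal (Real.exp (-l * s)) := by
  lift L to ℝ≥0 using hL0.le
  have hX := hW.continuous_bmPath s
  have hXm := hW.measurable_bmPath s
  set H : Set Ω := {ω | (hitSetPos h (bmPath W s · ω)).Nonempty} with hHdef
  have hH : MeasurableSet H := measurableSet_hitSetPos_nonempty hh hX hXm
  let τ : Ω → ℝ := fun ω => tauPos h (bmPath W s · ω)
  have hτ0 : ∀ ω, 0 ≤ τ ω := fun ω => Real.sInf_nonneg fun _ hα => hα.1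
  -- the hitting time rounded up to the grid of step `L / (n + 1)` is `grid n (κ n ω)`
  let grid : ℕ → ℕ → ℝ≥0 := fun n k => L * (k / (n + 1))
  let κ : ℕ → Ω → ℕ := fun n ω => ⌈τ ω / L * ((n : ℝ) + 1)⌉₊
  have hκ : ∀ n ω k, κ n ω ≤ k ↔ τ ω ≤ grid n k := by
    intro n ω k
    simp only [κ, grid, Nat.ceil_le]
    push_cast
    rw [div_mul_eq_mul_div, div_le_iff₀ hL0, ← mul_div_assoc, le_div_iff₀ (by positivity),
      mul_comm (k : ℝ)]
  have hκn : ∀ n, ∀ ω ∈ H, κ n ω ≤ n + 1 := fun n ω hω => by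
    rw [hκ]
    refine (tauPos_le hh (hX ω) hL hω).trans_eq ?_
    simp only [grid]
    push_cast
    field_simp
  let D : ℕ → ℕ → Set Ω := fun n k => {ω | ω ∈ H ∧ κ n ω = k}
  have hE : ∀ n k, MeasurableSet[pastSigma W (grid n k)] {ω | ω ∈ H ∧ κ n ω ≤ k} := by
    intro n k
    have : {ω | ω ∈ H ∧ κ n ω ≤ k} = {ω | HitBy h (bmPath W s · ω) (grid n k)} := by
      ext ω
      simp only [Set.mem_ofPred_eq, hitBy_iff hh (hX ω), hκ, hHdef]
      rfl
    rw [this]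
    exact measurableSet_hitBy hh hX fun r hr => measurable_bmPath_pastSigma W s hr.2
  have hgrid : ∀ n, Monotone (grid n) := fun n k k' hkk => by
    simp only [grid]
    gcongr
  have hD : ∀ n k, MeasurableSet[pastSigma W (grid n k)] (D n k) := by
    intro n k
    cases k with
    | zero => simpa only [D, Nat.le_zero] using hE n 0
    | succ k =>
      have : D n (k + 1) = {ω | ω ∈ H ∧ κ n ω ≤ k + 1} \ {ω | ω ∈ H ∧ κ n ω ≤ k} := by
        ext ω
        simp only [D, Set.mem_ofPred_eq, Set.mem_sdiff]
        constructor
        · rintro ⟨h1, h2⟩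
          exact ⟨⟨h1, h2.le⟩, fun h3 => by omega⟩
        · rintro ⟨⟨h1, h2⟩, h3⟩
          exact ⟨h1, by have : ¬ κ n ω ≤ k := fun h4 => h3 ⟨h1, h4⟩
                        omega⟩
      rw [this]
      exact (hE n (k + 1)).diff (pastSigma_mono W (hgrid n (Nat.le_succ k)) _ (hE n k))
  have hDm : ∀ n k, MeasurableSet (D n k) := fun n k => hW.pastSigma_le _ _ (hD n k)
  have hMm : ∀ t : ℝ≥0, Measurable fun ω => ENNReal.ofReal (expMart W s l t ω) := fun t =>
    ENNReal.measurable_ofReal.comp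
      ((measurable_expMart_pastSigma W s l t).mono (hW.pastSigma_le t) le_rfl)
  let G : ℕ → Ω → ℝ≥0∞ := fun n ω => ∑ k ∈ Finset.range (n + 2),
    (D n k).indicator (fun ω => ENNReal.ofReal (expMart W s l (grid n k) ω)) ω
  have hGm : ∀ n, Measurable (G n) := fun n =>
    Finset.measurable_sum _ fun k _ => (hMm _).indicator (hDm n k)
  have hGint : ∀ n, ∫⁻ ω, G n ω ∂P ≤ ENNReal.ofReal (Real.exp (-l * s)) := by
    intro n
    rw [lintegral_finsetSum _ fun k _ => (hMm _).indicator (hDm n k)]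
    calc ∑ k ∈ Finset.range (n + 2), ∫⁻ ω, (D n k).indicator
          (fun ω => ENNReal.ofReal (expMart W s l (grid n k) ω)) ω ∂P
        = ∑ k ∈ Finset.range (n + 2), ∫⁻ ω in D n k, ENNReal.ofReal (expMart W s l L ω) ∂P := by
          refine Finset.sum_congr rfl fun k hk => ?_
          rw [lintegral_indicator (hDm n k)]
          refine hW.setLIntegral_expMart s l ?_ (hD n k)
          have hk' : (k : ℝ≥0) ≤ n + 1 := by
            exact_mod_cast Nat.lt_succ_iff.1 (Finset.mem_range.1 hk)
          exact mul_le_of_le_one_right' (div_le_one_of_le₀ hk' (by positivity))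
      _ = ∫⁻ ω in ⋃ k ∈ Finset.range (n + 2), D n k, ENNReal.ofReal (expMart W s l L ω) ∂P := by
          refine (lintegral_biUnion_finset ?_ (fun k _ => hDm n k) _).symm
          intro k _ k' _ hkk
          refine Set.disjoint_left.2 fun ω h1 h2 => hkk (h1.2.symm.trans h2.2)
      _ ≤ ∫⁻ ω, ENNReal.ofReal (expMart W s l L ω) ∂P := setLIntegral_le_lintegral _ _
      _ = _ := hW.lintegral_expMart s l L
  have hGlim : ∀ ω ∈ H, Tendsto (fun n => G n ω) atTop
      (𝓝 (ENNReal.ofReal (expMart W s l (τ ω) ω))) := by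
    intro ω hω
    have hG : ∀ n, G n ω = ENNReal.ofReal (expMart W s l (grid n (κ n ω)) ω) := by
      intro n
      simp only [G]
      rw [Finset.sum_eq_single (κ n ω)]
      · exact Set.indicator_of_mem (s := D n (κ n ω)) ⟨hω, rfl⟩ _
      · exact fun k _ hk => Set.indicator_of_notMem (s := D n k) (fun hmem => hk hmem.2.symm) _
      · exact fun hk => absurd (Finset.mem_range.2 (Nat.lt_succ_of_le (hκn n ω hω))) hk
    have hlim : Tendsto (fun n => (grid n (κ n ω) : ℝ)) atTop (𝓝 (τ ω)) := by
      have h1 : Tendsto (fun n : ℕ => (n : ℝ) + 1) atTop atTop :=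
        tendsto_atTop_add_const_right _ _ tendsto_natCast_atTop_atTop
      have h2 := ((tendsto_nat_ceil_mul_div_atTop (div_nonneg (hτ0 ω) hL0.le)).comp h1).const_mul
        (L : ℝ)
      rw [mul_div_cancel₀ _ hL0.ne'] at h2
      refine h2.congr fun n => ?_
      simp only [grid, κ, Function.comp]
      push_cast
      rfl
    have hcont : Continuous fun t => ENNReal.ofReal (expMart W s l t ω) := by
      have := hX ω
      unfold expMart
      exact ENNReal.continuous_ofReal.comp (by fun_prop)
    simp_rw [hG]
    exact (hcont.tendsto (τ ω)).comp hlim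
  calc ∫⁻ ω in H, ENNReal.ofReal (expMart W s l (τ ω) ω) ∂P
      ≤ ∫⁻ ω, liminf (fun n => G n ω) atTop ∂P := by
        rw [← lintegral_indicator hH]
        refine lintegral_mono fun ω => ?_
        by_cases hω : ω ∈ H
        · rw [Set.indicator_of_mem hω, (hGlim ω hω).liminf_eq]
        · rw [Set.indicator_of_notMem hω]
          exact zero_le
    _ ≤ liminf (fun n => ∫⁻ ω, G n ω ∂P) atTop := lintegral_liminf_le hGm
    _ ≤ liminf (fun _ : ℕ => ENNReal.ofReal (Real.exp (-l * s))) atTop :=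
        liminf_le_liminf (Eventually.of_forall hGint)
    _ = _ := liminf_const _

/-! ### The expectation at the hitting time -/

/-- The expectation `E_{B(0) = s} [exp (-τ₊ ξ² - B(τ₊) ξ) 1_{τ₊ < ∞}]` for the path of
diffusivity `2` built from `W`. -/
noncomputable def stoppedExp (W : ℝ≥0 → Ω → ℝ) (P : Measure Ω) (h : ℝ → EReal) (ξ : ℂ) (s : ℝ) :
    ℂ :=
  ∫ ω, weightPos h ξ (bmPath W s · ω) ∂P

/-- The Gaussian tail of the event that the hypograph is hit, from the optional stopping
inequality with the optimal exponent `(s - β) / (2 L)`. -/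
lemma IsRegularBrownian.measure_hit_le (hW : IsRegularBrownian W P) {h : ℝ → EReal}
    (hh : UpperSemicontinuous h) {L β : ℝ} (hL0 : 0 < L) (hL : ∀ x, L < x → h x = ⊥)
    (hβ : ∀ x, h x ≤ β) {s : ℝ} (hs : β ≤ s) :
    P {ω | (hitSetPos h (bmPath W s · ω)).Nonempty} ≤
      ENNReal.ofReal (Real.exp (-(s - β) ^ 2 / (4 * L))) := by
  have hX := hW.continuous_bmPath s
  set H : Set Ω := {ω | (hitSetPos h (bmPath W s · ω)).Nonempty}
  have hH : MeasurableSet H :=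
    measurableSet_hitSetPos_nonempty hh hX (hW.measurable_bmPath s)
  set l : ℝ := (s - β) / (2 * L) with hl
  have hl0 : 0 ≤ l := div_nonneg (sub_nonneg.2 hs) (by positivity)
  have key : ENNReal.ofReal (Real.exp (-l ^ 2 * L - l * β)) * P H ≤
      ENNReal.ofReal (Real.exp (-l * s)) := by
    refine le_trans ?_ (hW.lintegral_expMart_tauPos_le hh hL0 hL s l)
    rw [← setLIntegral_const]
    refine setLIntegral_mono' hH fun ω hω => ENNReal.ofReal_le_ofReal (Real.exp_le_exp.2 ?_)
    have h1 := tauPos_le hh (hX ω) hL hω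
    have h2 : bmPath W s (tauPos h (bmPath W s · ω)) ω ≤ β :=
      EReal.coe_le_coe_iff.1 ((tauPos_mem hh (hX ω) hω).2.trans (hβ _))
    nlinarith [mul_le_mul_of_nonneg_left h1 (sq_nonneg l), mul_le_mul_of_nonneg_left h2 hl0]
  have hc : ENNReal.ofReal (Real.exp (-l ^ 2 * L - l * β)) ≠ 0 := by
    simpa using Real.exp_pos _
  rw [mul_comm, ← ENNReal.le_div_iff_mul_le (Or.inl hc) (Or.inl ENNReal.ofReal_ne_top),
    ← ENNReal.ofReal_div_of_pos (Real.exp_pos _), ← Real.exp_sub] at key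
  refine key.trans_eq ?_
  congr 2
  rw [hl]
  field_simp
  ring

lemma norm_weightPos_le_const {h : ℝ → EReal} (hh : UpperSemicontinuous h) {f : ℝ → ℝ}
    (hf : Continuous f) {L β : ℝ} (hL : ∀ x, L < x → h x = ⊥) (hβ : ∀ x, h x ≤ β) {ξ : ℂ}
    (hξ : ξ.re < 0) :
    ‖weightPos h ξ f‖ ≤ Real.exp (L * ξ.im ^ 2 - ξ.re * β) := by
  by_cases hne : (hitSetPos h f).Nonempty
  · refine (norm_weightPos_le hh hf hL ξ hne).trans ?_
    rw [← Real.exp_add]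
    refine Real.exp_le_exp.2 ?_
    have h0 := (tauPos_mem hh hf hne).1
    have h2 : f (tauPos h f) ≤ β :=
      EReal.coe_le_coe_iff.1 ((tauPos_mem hh hf hne).2.trans (hβ _))
    nlinarith [mul_nonneg (sq_nonneg ξ.re) h0]
  · rw [weightPos, if_neg hne, norm_zero]
    positivity

lemma IsRegularBrownian.integrable_weightPos (hW : IsRegularBrownian W P) {h : ℝ → EReal}
    (hh : UpperSemicontinuous h) {L β : ℝ} (hL : ∀ x, L < x → h x = ⊥)
    (hβ : ∀ x, h x ≤ β) {ξ : ℂ} (hξ : ξ.re < 0) (s : ℝ) :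
    Integrable (fun ω => weightPos h ξ (bmPath W s · ω)) P := by
  have hprob : IsProbabilityMeasure P :=
    hW.isPreBrownianReal.isGaussianProcess.isProbabilityMeasure
  refine Integrable.of_bound (measurable_weightPos hh (hW.continuous_bmPath s)
    (hW.measurable_bmPath s) ξ).aestronglyMeasurable _ (ae_of_all _ fun ω =>
      norm_weightPos_le_const hh (hW.continuous_bmPath s ω) hL hβ hξ)

lemma IsRegularBrownian.stronglyMeasurable_stoppedExp (hW : IsRegularBrownian W P)
    {h : ℝ → EReal} (hh : UpperSemicontinuous h) (ξ : ℂ) :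
    StronglyMeasurable (stoppedExp W P h ξ) := by
  have hprob : IsProbabilityMeasure P :=
    hW.isPreBrownianReal.isGaussianProcess.isProbabilityMeasure
  have : Measurable fun q : ℝ × Ω => weightPos h ξ (fun t => bmPath W q.1 t q.2) :=
    measurable_weightPos (X := fun t (q : ℝ × Ω) => bmPath W q.1 t q.2) hh
      (fun q => hW.continuous_bmPath q.1 q.2) (fun r => by
        have := hW.measurable_eval r.toNNReal
        unfold bmPath
        fun_prop) ξ
  exact StronglyMeasurable.integral_prod_right (ν := P)
    (f := fun s ω => weightPos h ξ (bmPath W s · ω)) this.stronglyMeasurable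

lemma IsRegularBrownian.differentiableOn_stoppedExp (hW : IsRegularBrownian W P)
    {h : ℝ → EReal} (hh : UpperSemicontinuous h) {L β : ℝ} (hL : ∀ x, L < x → h x = ⊥)
    (hβ : ∀ x, h x ≤ β) (s : ℝ) :
    DifferentiableOn ℂ (fun ξ => stoppedExp W P h ξ s) {ξ | ξ.re < 0} := by
  have hprob : IsProbabilityMeasure P :=
    hW.isPreBrownianReal.isGaussianProcess.isProbabilityMeasure
  have hopen : IsOpen {ξ : ℂ | ξ.re < 0} := isOpen_lt Complex.continuous_re continuous_const
  refine differentiableOn_integral_of_dominated hopen (fun ξ _ => (measurable_weightPos hh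
    (hW.continuous_bmPath s) (hW.measurable_bmPath s) ξ).aestronglyMeasurable) (fun ω => ?_) ?_
  · unfold weightPos
    split_ifs <;> fun_prop
  · intro ξ₀ hξ₀
    refine ⟨fun _ => Real.exp (L * ξ₀.im ^ 2 - ξ₀.re * β) + 1, integrable_const _, ?_⟩
    have hc : Continuous fun ξ : ℂ => Real.exp (L * ξ.im ^ 2 - ξ.re * β) := by fun_prop
    filter_upwards [hopen.mem_nhds hξ₀,
      hc.continuousAt.eventually (gt_mem_nhds (lt_add_one _))] with ξ hξ hlt ω
    exact (norm_weightPos_le_const hh (hW.continuous_bmPath s ω) hL hβ hξ).trans hlt.le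

/-- Below the level `β` the decay comes from optional stopping with the exponent `Re ξ`, above it
from the Gaussian tail of the hitting event. -/
lemma IsRegularBrownian.norm_stoppedExp_le (hW : IsRegularBrownian W P) {h : ℝ → EReal}
    (hh : UpperSemicontinuous h) {L β : ℝ} (hL0 : 0 < L) (hL : ∀ x, L < x → h x = ⊥)
    (hβ : ∀ x, h x ≤ β) {ξ : ℂ} (hξ : ξ.re < 0) (s : ℝ) :
    ‖stoppedExp W P h ξ s‖ ≤ Real.exp (L * ξ.im ^ 2 - ξ.re * β) *
      if s ≤ β then Real.exp (-ξ.re * (s - β)) else Real.exp (-(s - β) ^ 2 / (4 * L)) := by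
  have hX := hW.continuous_bmPath s
  have hH : MeasurableSet {ω | (hitSetPos h (bmPath W s · ω)).Nonempty} :=
    measurableSet_hitSetPos_nonempty hh hX (hW.measurable_bmPath s)
  have hind : ∫⁻ ω, ENNReal.ofReal ‖weightPos h ξ (bmPath W s · ω)‖ ∂P =
      ∫⁻ ω in {ω | (hitSetPos h (bmPath W s · ω)).Nonempty},
        ENNReal.ofReal ‖weightPos h ξ (bmPath W s · ω)‖ ∂P := by
    rw [← lintegral_indicator hH]
    refine lintegral_congr fun ω => ?_
    by_cases hω : (hitSetPos h (bmPath W s · ω)).Nonempty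
    · rw [Set.indicator_of_mem (by exact hω)]
    · rw [Set.indicator_of_notMem (by exact hω), weightPos, if_neg hω, norm_zero,
        ENNReal.ofReal_zero]
  refine (norm_integral_le_lintegral_norm _).trans
    (ENNReal.toReal_le_of_le_ofReal (by positivity) ?_)
  rw [hind]
  split_ifs with hs
  · have hsplit : Real.exp (L * ξ.im ^ 2 - ξ.re * β) * Real.exp (-ξ.re * (s - β)) =
        Real.exp (L * ξ.im ^ 2) * Real.exp (-ξ.re * s) := by
      rw [← Real.exp_add, ← Real.exp_add]
      congr 1
      ring
    rw [hsplit, ENNReal.ofReal_mul (Real.exp_pos _).le]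
    refine le_trans ?_ (mul_le_mul_right (hW.lintegral_expMart_tauPos_le hh hL0 hL s ξ.re) _)
    rw [← lintegral_const_mul' _ _ ENNReal.ofReal_ne_top]
    refine setLIntegral_mono' hH fun ω hω => ?_
    rw [← ENNReal.ofReal_mul (Real.exp_pos _).le]
    exact ENNReal.ofReal_le_ofReal (norm_weightPos_le hh (hX ω) hL ξ hω)
  · rw [ENNReal.ofReal_mul (Real.exp_pos _).le]
    refine le_trans ?_ (mul_le_mul_right (hW.measure_hit_le hh hL0 hL hβ (not_le.1 hs).le) _)
    rw [← setLIntegral_const]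
    exact setLIntegral_mono' hH fun ω _ => ENNReal.ofReal_le_ofReal
      (norm_weightPos_le_const hh (hX ω) hL hβ hξ)

/-! ### The envelope of the integrands -/

/-- The envelope of the integrands of `chi`: exponential decay at rate `d` below the level `β`, and
a Gaussian tail with drift `A` above it. -/
noncomputable def envelope (L β d A s : ℝ) : ℝ :=
  if s ≤ β then Real.exp (d * (s - β)) else Real.exp (A * (s - β) - (s - β) ^ 2 / (4 * L))

lemma envelope_eq_piecewise (L β d A : ℝ) : envelope L β d A =
    (Set.Iic β).piecewise (fun s => Real.exp (d * (s - β)))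
      (fun s => Real.exp (A * (s - β) - (s - β) ^ 2 / (4 * L))) := by
  ext s
  simp only [envelope, Set.piecewise, Set.mem_Iic]

lemma envelope_mono (L β : ℝ) {d d' A A' : ℝ} (hd : d' ≤ d) (hA : A ≤ A') (s : ℝ) :
    envelope L β d A s ≤ envelope L β d' A' s := by
  unfold envelope
  split_ifs with hs
  · exact Real.exp_le_exp.2 (mul_le_mul_of_nonpos_right hd (sub_nonpos.2 hs))
  · have : 0 ≤ s - β := sub_nonneg.2 (not_le.1 hs).le
    gcongr

lemma exp_drift_sub_sq {L : ℝ} (hL : 0 < L) (β A s : ℝ) :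
    Real.exp (A * (s - β) - (s - β) ^ 2 / (4 * L)) =
      Real.exp (A ^ 2 * L) * Real.exp (-(1 / (4 * L)) * (s - (β + 2 * L * A)) ^ 2) := by
  rw [← Real.exp_add]
  congr 1
  field_simp
  ring

lemma integrable_exp_drift {L : ℝ} (hL : 0 < L) (β A : ℝ) :
    Integrable fun s => Real.exp (A * (s - β) - (s - β) ^ 2 / (4 * L)) := by
  simp_rw [exp_drift_sub_sq hL]
  exact ((integrable_exp_neg_mul_sq (by positivity)).comp_sub_right _).const_mul _

lemma integral_exp_drift {L : ℝ} (hL : 0 < L) (β A : ℝ) :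
    ∫ s, Real.exp (A * (s - β) - (s - β) ^ 2 / (4 * L)) =
      √(4 * Real.pi * L) * Real.exp (A ^ 2 * L) := by
  simp_rw [exp_drift_sub_sq hL]
  rw [integral_const_mul,
    integral_sub_right_eq_self (fun s => Real.exp (-(1 / (4 * L)) * s ^ 2)), integral_gaussian,
    mul_comm]
  congr 2
  field_simp

lemma exp_mul_sub_eq (d β s : ℝ) :
    Real.exp (d * (s - β)) = Real.exp (-(d * β)) * Real.exp (d * s) := by
  rw [← Real.exp_add]
  congr 1
  ring

lemma integrableOn_exp_mul_sub {d : ℝ} (hd : 0 < d) (β : ℝ) :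
    IntegrableOn (fun s => Real.exp (d * (s - β))) (Set.Iic β) := by
  simp_rw [exp_mul_sub_eq]
  exact (integrableOn_exp_mul_Iic hd β).const_mul _

lemma integrable_envelope {L d : ℝ} (hL : 0 < L) (hd : 0 < d) (β A : ℝ) :
    Integrable (envelope L β d A) := by
  rw [envelope_eq_piecewise]
  exact Integrable.piecewise measurableSet_Iic (integrableOn_exp_mul_sub hd β)
    (integrable_exp_drift hL β A).integrableOn

lemma integral_envelope_le {L d : ℝ} (hL : 0 < L) (hd : 0 < d) (β A : ℝ) :
    ∫ s, envelope L β d A s ≤ 1 / d + √(4 * Real.pi * L) * Real.exp (A ^ 2 * L) := by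
  rw [envelope_eq_piecewise, integral_piecewise measurableSet_Iic (integrableOn_exp_mul_sub hd β)
    (integrable_exp_drift hL β A).integrableOn]
  refine add_le_add (le_of_eq ?_) ?_
  · simp_rw [exp_mul_sub_eq]
    rw [integral_const_mul, integral_exp_mul_Iic hd, ← mul_div_assoc, ← Real.exp_add]
    simp
  · rw [← integral_exp_drift hL β A]
    exact setIntegral_le_integral (integrable_exp_drift hL β A)
      (ae_of_all _ fun s => (Real.exp_pos _).le)

/-- The domain `ℂ_R × ℂ_L` of the kernel. -/
def halfPlanes : Set (ℂ × ℂ) := {η : ℂ | 0 < η.re} ×ˢ {ξ : ℂ | ξ.re < 0}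

/-- The constant in front of the envelope in the bounds on the integrands of `chi`. -/
noncomputable def envelopeConst (L β : ℝ) (p : ℂ × ℂ) : ℝ :=
  Real.exp (β * (p.1.re - p.2.re) + L * (p.1.im ^ 2 + p.2.im ^ 2))

/-- `F p` is, on `ℂ_R × ℂ_L`, bounded by the envelope with decay rate `Re η - Re ξ` and drift
`A p`. -/
def EnvelopeBound (L β : ℝ) (A : ℂ × ℂ → ℝ) (F : ℂ × ℂ → ℝ → ℂ) : Prop :=
  ∀ p ∈ halfPlanes, ∀ s,
    ‖F p s‖ ≤ envelopeConst L β p * envelope L β (p.1.re - p.2.re) (A p) s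

section

variable {L β : ℝ} {A : ℂ × ℂ → ℝ} {F : ℂ × ℂ → ℝ → ℂ}

lemma EnvelopeBound.integrable (hF : EnvelopeBound L β A F) (hL : 0 < L) {p : ℂ × ℂ}
    (hp : p ∈ halfPlanes) (hm : AEStronglyMeasurable (F p) volume) : Integrable (F p) := by
  have hd : 0 < p.1.re - p.2.re := sub_pos.2 (lt_trans hp.2 hp.1)
  exact ((integrable_envelope hL hd β (A p)).const_mul _).mono' hm (ae_of_all _ (hF p hp))

lemma EnvelopeBound.norm_integral_le (hF : EnvelopeBound L β A F) (hL : 0 < L) {p : ℂ × ℂ}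
    (hp : p ∈ halfPlanes) : ‖∫ s, F p s‖ ≤ envelopeConst L β p *
      (1 / (p.1.re - p.2.re) + √(4 * Real.pi * L) * Real.exp (A p ^ 2 * L)) := by
  have hd : 0 < p.1.re - p.2.re := sub_pos.2 (lt_trans hp.2 hp.1)
  refine (norm_integral_le_of_norm_le ((integrable_envelope hL hd β (A p)).const_mul _)
    (ae_of_all _ (hF p hp))).trans ?_
  rw [integral_const_mul]
  exact mul_le_mul_of_nonneg_left (integral_envelope_le hL hd β _) (Real.exp_pos _).le

lemma EnvelopeBound.analyticOnNhd (hF : EnvelopeBound L β A F) (hL : 0 < L) (hA : Continuous A)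
    (hm : ∀ p ∈ halfPlanes, AEStronglyMeasurable (F p) volume)
    (hdiff : ∀ s, DifferentiableOn ℂ (fun p => F p s) halfPlanes) :
    AnalyticOnNhd ℂ (fun p => ∫ s, F p s) halfPlanes := by
  have hU : IsOpen {η : ℂ | 0 < η.re} := isOpen_lt continuous_const Complex.continuous_re
  have hV : IsOpen {ξ : ℂ | ξ.re < 0} := isOpen_lt Complex.continuous_re continuous_const
  refine analyticOnNhd_integral_of_dominated hU hV hm hdiff fun p₀ hp₀ => ?_
  have hd : 0 < p₀.1.re - p₀.2.re := sub_pos.2 (lt_trans hp₀.2 hp₀.1)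
  refine ⟨fun s => (envelopeConst L β p₀ + 1) *
      envelope L β ((p₀.1.re - p₀.2.re) / 2) (A p₀ + 1) s,
    (integrable_envelope hL (half_pos hd) β _).const_mul _, ?_⟩
  have hc : Continuous (envelopeConst L β) := by
    unfold envelopeConst
    fun_prop
  have hd' : Continuous fun p : ℂ × ℂ => p.1.re - p.2.re := by fun_prop
  filter_upwards [(hU.prod hV).mem_nhds hp₀,
    hc.continuousAt.eventually (gt_mem_nhds (lt_add_one _)),
    hd'.continuousAt.eventually (lt_mem_nhds (half_lt_self hd)),
    hA.continuousAt.eventually (gt_mem_nhds (lt_add_one _))] with p hp h1 h2 h3 s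
  refine (hF p hp s).trans (mul_le_mul h1.le (envelope_mono L β h2.le h3.le s) ?_ ?_)
  · unfold envelope
    positivity
  · unfold envelopeConst
    positivity

end

section

/-- `E` satisfies the estimate of `IsRegularBrownian.norm_stoppedExp_le` in the variable `ξ`. -/
def StoppedBound (L β : ℝ) (E : ℂ → ℝ → ℂ) : Prop :=
  ∀ ξ : ℂ, ξ.re < 0 → ∀ s, ‖E ξ s‖ ≤ Real.exp (L * ξ.im ^ 2 - ξ.re * β) *
      if s ≤ β then Real.exp (-ξ.re * (s - β)) else Real.exp (-(s - β) ^ 2 / (4 * L))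

variable {L β : ℝ} {E₁ E₂ : ℂ → ℝ → ℂ}

lemma StoppedBound.first (h : StoppedBound L β E₁) (hL : 0 < L) :
    EnvelopeBound L β (fun p => p.1.re) (fun p s => Complex.exp (s * p.1) * E₁ p.2 s) := by
  intro p hp s
  rw [norm_mul, Complex.norm_exp, show ((s : ℂ) * p.1).re = s * p.1.re by simp]
  refine (mul_le_mul_of_nonneg_left (h p.2 hp.2 s) (Real.exp_pos _).le).trans ?_
  have h1 := mul_nonneg hL.le (sq_nonneg p.1.im)
  unfold envelope envelopeConst
  split_ifs <;>
  · simp only [← Real.exp_add]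
    refine Real.exp_le_exp.2 ?_
    ring_nf at h1 ⊢
    linarith

lemma StoppedBound.second (h : StoppedBound L β E₂) (hL : 0 < L) :
    EnvelopeBound L β (fun p => -p.2.re)
      (fun p s => Complex.exp (-s * p.2) * E₂ (-p.1) s) := by
  intro p hp s
  rw [norm_mul, Complex.norm_exp, show (-(s : ℂ) * p.2).re = -s * p.2.re by simp]
  have h0 : (-p.1).re < 0 := by simpa using hp.1
  refine (mul_le_mul_of_nonneg_left (h (-p.1) h0 s) (Real.exp_pos _).le).trans ?_
  have h1 := mul_nonneg hL.le (sq_nonneg p.2.im)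
  simp only [Complex.neg_re, Complex.neg_im]
  unfold envelope envelopeConst
  split_ifs <;>
  · simp only [← Real.exp_add]
    refine Real.exp_le_exp.2 ?_
    ring_nf at h1 ⊢
    linarith

lemma StoppedBound.third (h₁ : StoppedBound L β E₁) (h₂ : StoppedBound L β E₂) (hL : 0 < L) :
    EnvelopeBound L β (fun _ => 0) (fun p s => E₁ p.2 s * E₂ (-p.1) s) := by
  intro p hp s
  rw [norm_mul]
  have h0 : (-p.1).re < 0 := by simpa using hp.1
  refine (mul_le_mul (h₁ p.2 hp.2 s) (h₂ (-p.1) h0 s) (norm_nonneg _)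
    ((norm_nonneg _).trans (h₁ p.2 hp.2 s))).trans ?_
  have h1 : 0 ≤ (s - β) ^ 2 / (4 * L) := by positivity
  simp only [Complex.neg_re, Complex.neg_im]
  unfold envelope envelopeConst
  split_ifs <;>
  · simp only [← Real.exp_add]
    refine Real.exp_le_exp.2 ?_
    ring_nf at h1 ⊢
    linarith

end

/-! ### The explicit bound -/

/-- The error terms `√L` are absorbed by `8 + 8 L`, where the `8` is gained from
`exp (a + b) ≥ 1 + (a + b)` and `(a + b) (1 / a + 1 / b) ≥ 4`. -/
lemma envelope_sum_le {a b L : ℝ} (ha : 0 < a) (hb : 0 < b) (hL : 0 < L) :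
    3 * (1 / (a + b) + √(4 * Real.pi * L)) ≤
      Real.exp (a + b) * (2 / a + 2 / b + 8 * L) := by
  have h1 : 3 * √(4 * Real.pi * L) ≤ 8 + 8 * L := by
    -- `36 π L ≤ 256 L ≤ 64 (1 + L) ^ 2`
    have : √(4 * Real.pi * L) ≤ (8 + 8 * L) / 3 := by
      rw [Real.sqrt_le_left (by positivity)]
      have := Real.pi_lt_d2
      nlinarith [sq_nonneg (1 - L), mul_pos hL hL]
    linarith
  have h2 : 8 / (a + b) ≤ 2 / a + 2 / b := by
    rw [div_add_div _ _ ha.ne' hb.ne', div_le_div_iff₀ (by positivity) (by positivity)]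
    nlinarith [sq_nonneg (a - b)]
  have h3 : 1 + (a + b) ≤ Real.exp (a + b) := by linarith [Real.add_one_le_exp (a + b)]
  calc 3 * (1 / (a + b) + √(4 * Real.pi * L)) ≤ 3 / (a + b) + (8 + 8 * L) := by
        have : 3 * (1 / (a + b)) = 3 / (a + b) := by ring
        linarith
    _ ≤ (1 + (a + b)) * (8 / (a + b) + 8 * L) := by
        have h4 : (a + b) * (8 / (a + b)) = 8 := by field_simp
        have h5 : 3 / (a + b) ≤ 8 / (a + b) := by gcongr; norm_num
        nlinarith [mul_pos (add_pos ha hb) hL]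
    _ ≤ Real.exp (a + b) * (2 / a + 2 / b + 8 * L) := by gcongr

/-- The sum of the bounds on the three integrals of `chi` is at most the announced bound, whatever
the nonnegative term `X`. The factor `exp (L (a² + b²))`, with `a = Re η` and `b = -Re ξ`, that
comes from the Gaussian integrals combines with `envelopeConst` into
`exp (β (a + b) + L (‖ξ‖² + ‖η‖²))`. -/
lemma envelopeConst_mul_sum_le {L β X : ℝ} (hL : 0 < L) (hX : 0 ≤ X) {η ξ : ℂ} (hη : 0 < η.re)
    (hξ : ξ.re < 0) :
    envelopeConst L β (η, ξ) *
          (1 / (η.re - ξ.re) + √(4 * Real.pi * L) * Real.exp (η.re ^ 2 * L)) +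
        envelopeConst L β (η, ξ) *
          (1 / (η.re - ξ.re) + √(4 * Real.pi * L) * Real.exp ((-ξ.re) ^ 2 * L)) +
        envelopeConst L β (η, ξ) *
          (1 / (η.re - ξ.re) + √(4 * Real.pi * L) * Real.exp ((0 : ℝ) ^ 2 * L)) ≤
      Real.exp ((β + 1) * (η - ξ).re + 2 * L * (‖ξ‖ ^ 2 + ‖η‖ ^ 2)) *
        (2 / η.re + 2 / (-ξ).re + 8 * L + X) := by
  have hb : 0 < -ξ.re := neg_pos.2 hξ
  set Q : ℝ := Real.exp (L * (η.re ^ 2 + ξ.re ^ 2)) with hQ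
  have hQ1 : 1 ≤ Q := Real.one_le_exp (by positivity)
  have hc : 0 < envelopeConst L β (η, ξ) := Real.exp_pos _
  have hd : 0 < η.re - ξ.re := by linarith
  have hterm : ∀ x : ℝ, x ^ 2 ≤ η.re ^ 2 + ξ.re ^ 2 → envelopeConst L β (η, ξ) *
      (1 / (η.re - ξ.re) + √(4 * Real.pi * L) * Real.exp (x ^ 2 * L)) ≤
      envelopeConst L β (η, ξ) * (Q * (1 / (η.re - ξ.re) + √(4 * Real.pi * L))) := by
    intro x hx
    refine mul_le_mul_of_nonneg_left ?_ hc.le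
    have h1 : Real.exp (x ^ 2 * L) ≤ Q := Real.exp_le_exp.2 (by nlinarith)
    have h2 : 1 / (η.re - ξ.re) ≤ Q * (1 / (η.re - ξ.re)) :=
      le_mul_of_one_le_left (by positivity) hQ1
    have h3 := mul_le_mul_of_nonneg_left h1 (Real.sqrt_nonneg (4 * Real.pi * L))
    linarith
  have hsum := add_le_add (add_le_add (hterm η.re (by nlinarith [sq_nonneg ξ.re]))
    (hterm (-ξ.re) (by nlinarith [sq_nonneg η.re])))
    (hterm 0 (by rw [zero_pow two_ne_zero]; positivity))
  refine hsum.trans ?_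
  have hmain := envelope_sum_le hη hb hL
  rw [← sub_eq_add_neg] at hmain
  have hn : ‖ξ‖ ^ 2 + ‖η‖ ^ 2 = (ξ.re ^ 2 + ξ.im ^ 2) + (η.re ^ 2 + η.im ^ 2) := by
    rw [Complex.sq_norm, Complex.sq_norm, Complex.normSq_apply, Complex.normSq_apply]
    ring
  have hexp : envelopeConst L β (η, ξ) * Q * Real.exp (η.re - ξ.re) ≤
      Real.exp ((β + 1) * (η - ξ).re + 2 * L * (‖ξ‖ ^ 2 + ‖η‖ ^ 2)) := by
    rw [envelopeConst, hQ, ← Real.exp_add, ← Real.exp_add, hn, Complex.sub_re]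
    refine Real.exp_le_exp.2 ?_
    have : 0 ≤ L * ((ξ.re ^ 2 + ξ.im ^ 2) + (η.re ^ 2 + η.im ^ 2)) := by positivity
    simp only
    nlinarith
  calc _ = envelopeConst L β (η, ξ) * Q *
        (3 * (1 / (η.re - ξ.re) + √(4 * Real.pi * L))) := by ring
    _ ≤ envelopeConst L β (η, ξ) * Q *
        (Real.exp (η.re - ξ.re) * (2 / η.re + 2 / (-ξ.re) + 8 * L)) := by gcongr
    _ = envelopeConst L β (η, ξ) * Q * Real.exp (η.re - ξ.re) *
        (2 / η.re + 2 / (-ξ.re) + 8 * L) := by ring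
    _ ≤ _ := by
        rw [Complex.neg_re]
        refine mul_le_mul hexp ?_ (by positivity) (Real.exp_pos _).le
        linarith

/-! ### The two halves of the two-sided path -/

/-- An upper semicontinuous function attains its maximum on a compact interval, so a function of
`UC_c` is bounded above by a real number. -/
lemma IsUCc.exists_bound {h : ℝ → EReal} (hh : IsUCc h) :
    ∃ L β : ℝ, 0 < L ∧ (∀ x, L < |x| → h x = ⊥) ∧ ∀ x, h x ≤ β := by
  obtain ⟨L, hL, hbot⟩ := hh.exists_eq_bot
  obtain ⟨a, -, ha⟩ := UpperSemicontinuousOn.exists_isMaxOn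
    (Set.nonempty_Icc.2 (neg_le_self hL.le)) isCompact_Icc
    (hh.upperSemicontinuous.upperSemicontinuousOn (Set.Icc (-L) L))
  refine ⟨L, (h a).toReal, hL, hbot, fun x => ?_⟩
  by_cases hx : |x| ≤ L
  · exact (ha (abs_le.1 hx)).trans (EReal.le_coe_toReal (hh.ne_top a))
  · rw [hbot x (not_le.1 hx)]
    exact bot_le

lemma eq_bot_of_supp_subset {h : ℝ → EReal} {L : ℝ} (hs : supp h ⊆ Set.Icc (-L) L) {x : ℝ}
    (hx : L < |x|) : h x = ⊥ := by
  by_contra hcon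
  exact absurd (abs_le.2 (hs (subset_closure hcon))) (not_le.2 hx)

/-- The half of the path at positive times, up to a null set, is `bmPath` of a regular Brownian
motion. -/
lemma IsTwoSidedBrownian.exists_pos {B : ℝ → Ω → ℝ} (hB : IsTwoSidedBrownian B P) :
    ∃ W, IsRegularBrownian W P ∧
    ∀ (h : ℝ → EReal) (ξ : ℂ) (s : ℝ), (fun ω => weightPos h ξ (fun t => s + B t ω)) =ᵐ[P]
      fun ω => weightPos h ξ (bmPath W s · ω) := by
  obtain ⟨W, hW, hae⟩ := exists_isRegularBrownian hB.pos
  refine ⟨W, hW, fun h ξ s => ?_⟩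
  filter_upwards [hae] with ω hω
  refine weightPos_congr fun t ht => ?_
  rw [bmPath, ← hω, Real.coe_toNNReal t ht, mul_inv_cancel_left₀ (by positivity)]

/-- The half of the path at negative times, reversed, turns `weightNeg` into `weightPos`. -/
lemma IsTwoSidedBrownian.exists_neg {B : ℝ → Ω → ℝ} (hB : IsTwoSidedBrownian B P) :
    ∃ W, IsRegularBrownian W P ∧
    ∀ (h : ℝ → EReal) (η : ℂ) (s : ℝ), (fun ω => weightNeg h η (fun t => s + B t ω)) =ᵐ[P]
      fun ω => weightPos (fun x => h (-x)) (-η) (bmPath W s · ω) := by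
  obtain ⟨W, hW, hae⟩ := exists_isRegularBrownian hB.neg
  refine ⟨W, hW, fun h ξ s => ?_⟩
  filter_upwards [hae] with ω hω
  rw [weightNeg_eq_weightPos]
  refine weightPos_congr fun t ht => ?_
  rw [bmPath, ← hω, Real.coe_toNNReal t ht, mul_inv_cancel_left₀ (by positivity)]

end KPZ

theorem proposition2p2 {Ω : Type*} [MeasurableSpace Ω] (P : Measure Ω) (B : ℝ → Ω → ℝ)
    (hB : KPZ.IsTwoSidedBrownian B P) (h : ℝ → EReal) (hh : KPZ.IsUCc h) :
    (∀ η ξ : ℂ, 0 < η.re → ξ.re < 0 → KPZ.ChiWellDefined B P h η ξ) ∧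
    AnalyticOnNhd ℂ (fun p : ℂ × ℂ => KPZ.chi B P h p.1 p.2)
      ({η : ℂ | 0 < η.re} ×ˢ {ξ : ℂ | ξ.re < 0}) ∧
    ∀ L β : ℝ, 0 < L → KPZ.supp h ⊆ Set.Icc (-L) L → (∀ α : ℝ, h α ≤ (β : EReal)) →
      ∀ η ξ : ℂ, 0 < η.re → ξ.re < 0 →
        ‖KPZ.chi B P h η ξ‖ ≤
          Real.exp ((β + 1) * (η - ξ).re + 2 * L * (‖ξ‖ ^ 2 + ‖η‖ ^ 2)) *
            (2 / η.re + 2 / (-ξ).re + 8 * L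
              + (2 : ℝ) ^ (5 / 2 : ℝ) * L ^ (3 / 2 : ℝ) / √Real.pi) := by
  open KPZ in
  obtain ⟨W, hW, hpos⟩ := hB.exists_pos
  obtain ⟨V, hV, hneg⟩ := hB.exists_neg
  have hu := hh.upperSemicontinuous
  have hu' : UpperSemicontinuous fun x => h (-x) := fun x c hc =>
    continuous_neg.continuousAt.eventually (hu (-x) c hc)
  have eP : ∀ ξ s, expectPos B P h ξ s = stoppedExp W P h ξ s := fun ξ s =>
    integral_congr_ae (hpos h ξ s)
  have eN : ∀ η s, expectNeg B P h η s = stoppedExp V P (fun x => h (-x)) (-η) s := fun η s =>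
    integral_congr_ae (hneg h η s)
  have mP := hW.stronglyMeasurable_stoppedExp hu
  have mN := hV.stronglyMeasurable_stoppedExp hu'
  have bdd : ∀ L β : ℝ, 0 < L → (∀ x, L < |x| → h x = ⊥) → (∀ x, h x ≤ β) →
      StoppedBound L β (stoppedExp W P h) ∧
      StoppedBound L β (stoppedExp V P (fun x => h (-x))) := fun L β hL hbot hβ =>
    ⟨fun ξ hξ s => hW.norm_stoppedExp_le hu hL
      (fun x hx => hbot x (hx.trans_le (le_abs_self x))) hβ hξ s,
    fun ξ hξ s => hV.norm_stoppedExp_le hu' hL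
      (fun x hx => hbot (-x) (hx.trans_le (by rw [abs_neg]; exact le_abs_self x)))
      (fun x => hβ (-x)) hξ s⟩
  have m1 : ∀ p : ℂ × ℂ, AEStronglyMeasurable
      (fun s : ℝ => Complex.exp (s * p.1) * stoppedExp W P h p.2 s) volume := fun p =>
    (Continuous.aestronglyMeasurable (by fun_prop)).mul (mP p.2).aestronglyMeasurable
  have m2 : ∀ p : ℂ × ℂ, AEStronglyMeasurable (fun s : ℝ => Complex.exp (-s * p.2) *
      stoppedExp V P (fun x => h (-x)) (-p.1) s) volume := fun p =>
    (Continuous.aestronglyMeasurable (by fun_prop)).mul (mN (-p.1)).aestronglyMeasurable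
  have m3 : ∀ p : ℂ × ℂ, AEStronglyMeasurable (fun s : ℝ => stoppedExp W P h p.2 s *
      stoppedExp V P (fun x => h (-x)) (-p.1) s) volume := fun p =>
    (mP p.2).aestronglyMeasurable.mul (mN (-p.1)).aestronglyMeasurable
  -- absolute convergence and analyticity use one fixed pair `(L₀, β₀)`, the final bound every pair
  obtain ⟨L₀, β₀, hL₀, hbot₀, hβ₀⟩ := hh.exists_bound
  obtain ⟨b₁, b₂⟩ := bdd L₀ β₀ hL₀ hbot₀ hβ₀
  have hL₁ : ∀ x, L₀ < x → h x = ⊥ := fun x hx => hbot₀ x (hx.trans_le (le_abs_self x))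
  have hL₂ : ∀ x, L₀ < x → h (-x) = ⊥ := fun x hx =>
    hbot₀ (-x) (hx.trans_le (by rw [abs_neg]; exact le_abs_self x))
  refine ⟨fun η ξ hη hξ => ?_, ?_, fun L β hL hsupp hβ η ξ hη hξ => ?_⟩
  · have hp : (η, ξ) ∈ halfPlanes := ⟨hη, hξ⟩
    refine ⟨fun s => ?_, fun s => ?_, ?_, ?_, ?_⟩
    · exact (integrable_congr (hpos h ξ s)).2 (hW.integrable_weightPos hu hL₁ hβ₀ hξ s)
    · exact (integrable_congr (hneg h η s)).2
        (hV.integrable_weightPos hu' hL₂ (fun x => hβ₀ (-x)) (by simpa using hη) s)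
    · have := (b₁.first hL₀).integrable hL₀ hp (m1 (η, ξ))
      simpa only [eP] using this
    · have := (b₂.second hL₀).integrable hL₀ hp (m2 (η, ξ))
      simpa only [eN] using this
    · have := (b₁.third b₂ hL₀).integrable hL₀ hp (m3 (η, ξ))
      simpa only [eP, eN] using this
  · have dP : ∀ s, DifferentiableOn ℂ (fun p : ℂ × ℂ => stoppedExp W P h p.2 s) halfPlanes :=
      fun s => (hW.differentiableOn_stoppedExp hu hL₁ hβ₀ s).comp differentiableOn_snd
        fun p hp => hp.2
    have dN : ∀ s, DifferentiableOn ℂ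
        (fun p : ℂ × ℂ => stoppedExp V P (fun x => h (-x)) (-p.1) s) halfPlanes :=
      fun s => (hV.differentiableOn_stoppedExp hu' hL₂ (fun x => hβ₀ (-x)) s).comp
        (f := fun p : ℂ × ℂ => -p.1) differentiableOn_fst.neg
        fun p hp => by simpa using hp.1
    have a₁ := (b₁.first hL₀).analyticOnNhd hL₀ (by fun_prop) (fun p _ => m1 p)
      fun s => DifferentiableOn.mul (by fun_prop) (dP s)
    have a₂ := (b₂.second hL₀).analyticOnNhd hL₀ (by fun_prop) (fun p _ => m2 p)
      fun s => DifferentiableOn.mul (by fun_prop) (dN s)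
    have a₃ := (b₁.third b₂ hL₀).analyticOnNhd hL₀ (by fun_prop) (fun p _ => m3 p)
      fun s => (dP s).mul (dN s)
    simp only [chi, eP, eN]
    exact (a₁.add a₂).sub a₃
  · have hp : (η, ξ) ∈ halfPlanes := ⟨hη, hξ⟩
    obtain ⟨c₁, c₂⟩ := bdd L β hL (fun x hx => eq_bot_of_supp_subset hsupp hx) hβ
    simp only [chi, eP, eN]
    refine (norm_sub_le _ _).trans ((add_le_add_left (norm_add_le _ _) _).trans ?_)
    refine le_trans ?_ (envelopeConst_mul_sum_le hL (by positivity) hη hξ)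
    have i₁ := (c₁.first hL).norm_integral_le hL hp
    have i₂ := (c₂.second hL).norm_integral_le hL hp
    have i₃ := (c₁.third c₂ hL).norm_integral_le hL hp
    exact add_le_add (add_le_add i₁ i₂) i₃
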